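/- Let $K$ be a commutative semiring. A weighted linear indexed grammar (WLIG) over $K$ consists of finite sets $N$ of nonterminals, $\Sigma$ of terminals and $\Gamma$ of stack symbols, a start symbol $S\in N$ with an initial stack in $\Gamma^*$, and a finite set of productions $p$ with weights $\delta(p)\in K$, each of the form $X[..\gamma]\to\Upsilon\,X'[..\gamma']\,\Upsilon'$ or $X[\gamma]\to a$, where $X,X'\in N$, $\gamma,\gamma'\in\Gamma^*$, $\Upsilon,\Upsilon'\in(N[\Gamma^*]\cup\Sigma)^*$ and $a\in\Sigma\cup\{\varepsilon\}$. A production of the first form rewrites $X[\rho\gamma]$ to $\Upsilon\,X'[\rho\gamma']\,\Upsilon'$ for any $\rho\in\Gamma^*$ (the top of a stack is its right end); one of the second form rewrites $X[\gamma]$ (with stack exactly $\gamma$) to $a$. For a string $s\in\Sigma^*$ let $D(G,s)$ be the set of leftmost derivations of $s$ from the start symbol with the initial stack (in each step the leftmost nonterminal is rewritten; this counts each derivation tree once). The weight of a derivation is the product of the weights of its productions, the stringsum of $s$ is the sum of the weights of all $d\in D(G,s)$, and the language of $G$ is $\{s: D(G,s)\ne\emptyset\}$. Two WLIGs over $K$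 with the same terminals are weakly equivalent if they have the same language and every string has the same stringsum in both. A WLIG is top-down if, for some $s_0\in\Gamma$, its initial stack is $[s_0]$ and all its productions are of the form $X[..A]\to\Upsilon\,X'[..\gamma]\,\Upsilon'$ or $X[A]\to a$ with $A\in\Gamma$, $\gamma\in\Gamma^*$, $a\in\Sigma\cup\{\varepsilon\}$, where every nonterminal in $\Upsilon,\Upsilon'$ carries the stack $[s_0]$. A top-down WLIG is in normal form if all its productions are of one of the forms $$X[..A]\to Y[s_0]\,Z[..\gamma],\quad X[..A]\to Y[..\gamma]\,Z[s_0],\quad X[..A]\to Y[..BC],\quad X[A]\to a,\quad S[s_0]\to\varepsilon,$$ where $X,Y,Z\in N$, $A,B,C\in\Gamma$, $\gamma\in\Gamma^*$ with $|\gamma|\le 2$, $a\in\Sigma$, and $S$ is the start symbol. Then every top-down WLIG $G$ over $K$ is weakly equivalent to a top-down WLIG in normal form over $K$, in each of the following two settings, in which all stringsums are defined. (1) $K$ is countably complete: every countable family in $K$ has a sum, these sums extend the finite sums, satisfy $\sum_{i\in I}a_i=\sum_{j\in J}\sum_{i\in I_j}a_i$ for every partition $I=\bigsqcup_{j\in J}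 I_j$ (parts may be empty), and multiplication distributes over them. (2) $K$ is an arbitrary commutative semiring and $D(G,s)$ is finite for every $s\in\Sigma^*$; then the normal-form grammar $G'$ can be chosen so that $D(G',s)$ is finite for every $s\in\Sigma^*$ as well. -/

import Mathlib

/-- Countable sums on a semiring: every countably indexed family has a sum, the sums extend the
finite ones, are invariant under partitions of the index set, and multiplication distributes over
them.  A semiring with such sums is a (countably) complete semiring; every continuous semiring is
one. -/
class CountableSums (K : Type*) [Semiring K] where
  /-- the sum of a countable family -/
  csum : ∀ {ι : Type} [Countable ι], (ι → K) → K
  csum_empty : ∀ {ι : Type} [Countable ι] [IsEmpty ι] (f : ι → K), csum f = 0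
  csum_single : ∀ (f : Unit → K), csum f = f ()
  csum_pair : ∀ (f : Bool → K), csum f = f false + f true
  csum_partition : ∀ {ι κ : Type} [Countable ι] [Countable κ] (p : ι → κ) (f : ι → K),
    csum f = csum fun j : κ => csum fun i : {i : ι // p i = j} => f i
  mul_csum : ∀ {ι : Type} [Countable ι] (a : K) (f : ι → K),
    a * csum f = csum fun i => a * f i
  csum_mul : ∀ {ι : Type} [Countable ι] (a : K) (f : ι → K),
    csum f * a = csum fun i => f i * a

namespace LIG

/-- A symbol of a sentential form: a nonterminal with its stack (written bottom to top, so that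
the top is the last element), or a terminal. -/
inductive Sym (T N Γ : Type) : Type
  | nt (X : N) (σ : List Γ)
  | tm (a : T)

/-- Sentential forms. -/
abbrev SForm (T N Γ : Type) : Type := List (Sym T N Γ)

/-- Productions.  `spine X γ l X' γ' r` is `X[..γ] → l X'[..γ'] r`; `leaf X γ a` is
`X[γ] → a`, where `a = none` stands for the empty string. -/
inductive Production (T N Γ : Type) : Type
  | spine (X : N) (γ : List Γ) (l : SForm T N Γ) (X' : N) (γ' : List Γ) (r : SForm T N Γ)
  | leaf (X : N) (γ : List Γ) (a : Option T)

/-- `LeftmostStep p β β'`: applying the production `p` to the leftmost nonterminal of `β`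
gives `β'`. -/
inductive LeftmostStep {T N Γ : Type} : Production T N Γ → SForm T N Γ → SForm T N Γ → Prop
  | spine (u : List T) (v : SForm T N Γ) (X : N) (ρ γ : List Γ) (l : SForm T N Γ) (X' : N)
      (γ' : List Γ) (r : SForm T N Γ) :
      LeftmostStep (.spine X γ l X' γ' r)
        (u.map .tm ++ .nt X (ρ ++ γ) :: v)
        (u.map .tm ++ (l ++ .nt X' (ρ ++ γ') :: r) ++ v)
  | leaf (u : List T) (v : SForm T N Γ) (X : N) (γ : List Γ) (a : Option T) :
      LeftmostStep (.leaf X γ a)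
        (u.map .tm ++ .nt X γ :: v)
        (u.map .tm ++ a.toList.map .tm ++ v)

/-- The sequence `p₁, β₁, …, pₙ, βₙ` of productions and sentential forms, preceded by `β`, is a
leftmost derivation of the string `s` from `β` with productions in `P`. -/
def IsDerivation {T N Γ : Type} (P : Finset (Production T N Γ)) :
    SForm T N Γ → List (Production T N Γ × SForm T N Γ) → List T → Prop
  | β, [], s => β = s.map .tm
  | β, (p, β') :: d, s => p ∈ P ∧ LeftmostStep p β β' ∧ IsDerivation P β' d s

/-- Helper: there are countably many symbols. -/
instance {T N Γ : Type} [Countable T] [Countable N] [Countable Γ] : Countable (Sym T N Γ) := by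
  have h : Function.Injective (fun x : Sym T N Γ => match x with
      | .nt X σ => (Sum.inl (X, σ) : (N × List Γ) ⊕ T)
      | .tm a => Sum.inr a) := by
    rintro (⟨X, σ⟩ | a) (⟨Y, τ⟩ | b) <;> simp
  exact h.countable

/-- Helper: there are countably many productions. -/
instance {T N Γ : Type} [Countable T] [Countable N] [Countable Γ] :
    Countable (Production T N Γ) := by
  have h : Function.Injective (fun p : Production T N Γ => match p with
      | .spine X γ l X' γ' r => (Sum.inl (X, γ, l, X', γ', r) :
          (N × List Γ × SForm T N Γ × N × List Γ × SForm T N Γ) ⊕ (N × List Γ × Option T))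
      | .leaf X γ a => Sum.inr (X, γ, a)) := by
    rintro (⟨X, γ, l, X', γ', r⟩ | ⟨X, γ, a⟩) (⟨Y, δ, m, Y', δ', q⟩ | ⟨Y, δ, b⟩) <;> simp
  exact h.countable

end LIG

open LIG in
/-- A weighted linear indexed grammar with weights in `K`, terminals `T`, nonterminals `N` and
stack symbols `Γ` (the three alphabets are assumed finite where grammars are quantified over).
Only the weights of productions in `rules` matter. -/
structure WLIG (K : Type*) (T N Γ : Type) where
  rules : Finset (Production T N Γ)
  start : N
  initStack : List Γ
  weight : Production T N Γ → K

namespace WLIG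

open LIG

variable {K : Type*} {T N Γ N' Γ' : Type}

/-- The set `D(G, s)` of leftmost derivations of the string `s` from the start symbol with the
initial stack. -/
def derivations (G : WLIG K T N Γ) (s : List T) :
    Set (List (Production T N Γ × SForm T N Γ)) :=
  {d | IsDerivation G.rules [.nt G.start G.initStack] d s}

/-- The language of `G`. -/
def language (G : WLIG K T N Γ) : Set (List T) := {s | (G.derivations s).Nonempty}

/-- The weight of a derivation: the product of the weights of its productions. -/
def derivationWeight [Semiring K] (G : WLIG K T N Γ)
    (d : List (Production T N Γ × SForm T N Γ)) : K :=
  (d.map fun q => G.weight q.1).prod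

/-- The stringsum of `s`, over a semiring with countable sums. -/
def stringsum [Semiring K] [CountableSums K] [Finite T] [Finite N] [Finite Γ]
    (G : WLIG K T N Γ) (s : List T) : K :=
  CountableSums.csum fun d : G.derivations s => G.derivationWeight d.1

/-- Every string has only finitely many derivations, so that its stringsum is a finite sum, which
makes sense in every semiring. -/
def FinitelyAmbiguous (G : WLIG K T N Γ) : Prop := ∀ s, (G.derivations s).Finite

/-- The stringsum of `s` as a finite sum (meaningful if `s` has finitely many derivations). -/
noncomputable def finStringsum [Semiring K] (G : WLIG K T N Γ) (s : List T) : K :=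
  ∑ᶠ d ∈ G.derivations s, G.derivationWeight d

/-- Weak equivalence over a semiring with countable sums: same language, same stringsums. -/
def WeaklyEquivalent [Semiring K] [CountableSums K] [Finite T] [Finite N] [Finite Γ] [Finite N']
    [Finite Γ'] (G : WLIG K T N Γ) (G' : WLIG K T N' Γ') : Prop :=
  G.language = G'.language ∧ ∀ s, G.stringsum s = G'.stringsum s

/-- Weak equivalence of grammars all of whose stringsums are finite sums. -/
def FinWeaklyEquivalent [Semiring K] (G : WLIG K T N Γ) (G' : WLIG K T N' Γ') : Prop :=
  G.language = G'.language ∧ ∀ s, G.finStringsum s = G'.finStringsum s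

/-- The two forms of productions of a top-down grammar with initial stack `[s₀]`:
`X[..A] → l X'[..γ] r`, with every nonterminal in `l` and `r` carrying the stack `[s₀]`, and
`X[A] → a`, `a` a terminal or the empty string. -/
inductive TopDownRule (s₀ : Γ) : Production T N Γ → Prop
  | spine (X : N) (A : Γ) (l : SForm T N Γ) (X' : N) (γ : List Γ) (r : SForm T N Γ)
      (hl : ∀ Y σ, Sym.nt Y σ ∈ l → σ = [s₀]) (hr : ∀ Y σ, Sym.nt Y σ ∈ r → σ = [s₀]) :
      TopDownRule s₀ (.spine X [A] l X' γ r)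
  | leaf (X : N) (A : Γ) (a : Option T) : TopDownRule s₀ (.leaf X [A] a)

/-- Top-down grammars. -/
def IsTopDown (G : WLIG K T N Γ) : Prop :=
  ∃ s₀ : Γ, G.initStack = [s₀] ∧ ∀ p ∈ G.rules, TopDownRule s₀ p

/-- The five forms of productions of a grammar in normal form with start symbol `S` and initial
stack `[s₀]`. -/
inductive NormalFormRule (S : N) (s₀ : Γ) : Production T N Γ → Prop
  /-- `X[..A] → Y[s₀] Z[..γ]` with `|γ| ≤ 2` -/
  | binRight (X : N) (A : Γ) (Y Z : N) (γ : List Γ) (hγ : γ.length ≤ 2) :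
      NormalFormRule S s₀ (.spine X [A] [.nt Y [s₀]] Z γ [])
  /-- `X[..A] → Y[..γ] Z[s₀]` with `|γ| ≤ 2` -/
  | binLeft (X : N) (A : Γ) (Y Z : N) (γ : List Γ) (hγ : γ.length ≤ 2) :
      NormalFormRule S s₀ (.spine X [A] [] Y γ [.nt Z [s₀]])
  /-- `X[..A] → Y[..BC]` -/
  | push (X : N) (A : Γ) (Y : N) (B C : Γ) :
      NormalFormRule S s₀ (.spine X [A] [] Y [B, C] [])
  /-- `X[A] → a` with `a` a terminal -/
  | terminal (X : N) (A : Γ) (a : T) : NormalFormRule S s₀ (.leaf X [A] (some a))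
  /-- `S[s₀] → ε` -/
  | startEmpty : NormalFormRule S s₀ (.leaf S [s₀] none)

/-- Normal form of top-down grammars. -/
def IsNormalForm (G : WLIG K T N Γ) : Prop :=
  ∃ s₀ : Γ, G.initStack = [s₀] ∧ ∀ p ∈ G.rules, NormalFormRule G.start s₀ p

end WLIG

/-!
In a top-down grammar all side nonterminals start with the stack `[s₀]`, so a derivation tree
consists of trunks, along which the stack is handed down, and each trunk is a run of a pushdown
automaton.  The part of a trunk during which a segment of the stack is popped, together with the
trees that hang on it, derives a pair of strings, one on each side of the gap at which the trunk
goes on.  Cutting the runs at the moments when segments have been popped turns the grammar into a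
`HeadGrammar` with finitely many sorts and three kinds of rules: leaves, side trees (whose pair is
joined and put on one side of the gap) and compositions (one pair nested into another).  Its trees
correspond to the leftmost derivations, with the same weights (`LIG.exists_headGrammar`).

To get rid of the empty string, the null subtrees of a tree of the head grammar and the unary nodes
that remain are contracted (`HeadGrammar.Tree.contract`). There are two modes. In pair mode the
derived pair of strings matters. String mode applies to the root of every side tree and to the
innermost part of every trunk; there only the concatenation of the pair matters, so that a trunk
that ends with the empty string can be continued in its last nonempty side tree. The trees with a
given contraction are the independent choices of a unary path above each node, so that the sum of
their weights is a product of sums over unary paths (`HeadGrammar.sum_fiber`). These sums become the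
weights of the productions of a top-down grammar whose stack symbols are sorts: a stack is a
sequence of pairs to be nested, a composition is a production `X[..A] → Y[..BC]`, and the leaves and
side rules in pair mode pop a symbol while emitting a terminal or a side tree. Its productions are
in normal form, and its derivations are the contracted trees (`HeadGrammar.Obj.model`).

Hence contraction is a surjection from the derivations of a string in the given grammar onto those
in the normal form grammar, and every derivation weighs as much as its fibre
(`HeadGrammar.sum_contractTo`).  Surjectivity gives the equality of the languages and the finiteness
of the derivations in the second setting.  The weights of productions
that occur in no derivation do not matter; every other sum is over a quotient of a subset of the
set of derivations of some string.  With sums over finite or over countable types, as described by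
`Summation`, both settings are thus instances of `WLIG.exists_normalForm`.
-/

open LIG

/-! ### Finite and countable sums -/

/-- A notion of sums in `K` over a class `Dom` of index types: all countable types if `K` has
countable sums, all finite types otherwise.  Families over other types have a junk value as sum;
for this reason `sum_fiberwise` asks for a surjective map, whose codomain is again in the
class. -/
structure Summation (K : Type*) [CommSemiring K] where
  /-- the index types over which sums are meaningful -/
  Dom : Type → Prop
  /-- the sum of a family -/
  sum : {ι : Type} → (ι → K) → K
  dom_of_surjective : ∀ {ι κ : Type} (f : ι → κ), Function.Surjective f → Dom ι → Dom κ
  dom_of_injective : ∀ {ι κ : Type} (f : ι → κ), Function.Injective f → Dom κ → Dom ι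
  sum_unique : ∀ {ι : Type} [Unique ι] (f : ι → K), sum f = f default
  sum_fiberwise : ∀ {ι κ : Type} (p : ι → κ), Function.Surjective p → Dom ι → ∀ f : ι → K,
    sum f = sum fun j : κ => sum fun i : {i : ι // p i = j} => f i
  mul_sum : ∀ {ι : Type}, Dom ι → ∀ (a : K) (f : ι → K), a * sum f = sum fun i => a * f i

namespace Summation

variable {K : Type*} [CommSemiring K] (S : Summation K) {ι κ : Type}

theorem dom_equiv (e : ι ≃ κ) (h : S.Dom ι) : S.Dom κ := S.dom_of_surjective e e.surjective h

theorem sum_equiv (e : ι ≃ κ) (h : S.Dom ι) (f : ι → K) (g : κ → K) (hfg : ∀ i, g (e i) = f i) :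
    S.sum f = S.sum g := by
  rw [S.sum_fiberwise e e.surjective h]
  congr 1
  funext j
  let _ : Unique {i : ι // e i = j} :=
    ⟨⟨⟨e.symm j, by simp⟩⟩, fun i => Subtype.ext (by simp [← i.2])⟩
  rw [S.sum_unique, ← hfg]
  exact congrArg g (default : {i : ι // e i = j}).2

/-- The product of two sums.  If both index types are nonempty, they inherit membership in the
class `Dom` from their product; without that, one of them could be empty and the other arbitrary. -/
theorem sum_mul_sum [Nonempty ι] [Nonempty κ] (h : S.Dom (ι × κ)) (f : ι → K) (g : κ → K) :
    (S.sum fun x : ι × κ => f x.1 * g x.2) = S.sum f * S.sum g := by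
  have h1 : S.Dom ι := S.dom_of_surjective Prod.fst Prod.fst_surjective h
  have h2 : S.Dom κ := S.dom_of_surjective Prod.snd Prod.snd_surjective h
  rw [S.sum_fiberwise Prod.fst Prod.fst_surjective h, mul_comm, S.mul_sum h1]
  congr 1
  funext i
  rw [mul_comm, S.mul_sum h2]
  let e : κ ≃ {x : ι × κ // x.1 = i} :=
    ⟨fun b => ⟨(i, b), rfl⟩, fun x => x.1.2, fun _ => rfl, fun x => by
      obtain ⟨⟨a, b⟩, rfl⟩ := x; rfl⟩
  exact (S.sum_equiv e h2 _ _ fun _ => rfl).symm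

/-- A map all of whose fibres are nonempty and have the sums prescribed by `g` preserves sums. -/
theorem sum_eq_of_fibers (p : ι → κ) (hp : Function.Surjective p) (h : S.Dom ι) (f : ι → K)
    (g : κ → K) (hg : ∀ j, S.Dom {i : ι // p i = j} →
      (S.sum fun i : {i : ι // p i = j} => f i) = g j) :
    S.sum f = S.sum g := by
  rw [S.sum_fiberwise p hp h]
  congr 1
  funext j
  exact hg j (S.dom_of_injective Subtype.val Subtype.val_injective h)

end Summation

namespace CountableSums

variable {K : Type*} [CommSemiring K] [CountableSums K]

/-- The axioms provide the sum over `Unit` only; for another one-element type `ι`, the family over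
`Unit` is partitioned along `Unit → ι`, whose fibre is again `Unit`, up to the predicate that cuts
it out. -/
theorem csum_unique {ι : Type} [Countable ι] [Unique ι] (f : ι → K) : csum f = f default := by
  have key : ∀ (P : Unit → Prop), (∀ i, P i) → ∀ a : K, (csum fun _ : {i // P i} => a) = a := by
    intro P hP a
    have h := csum_partition (K := K) (fun _ : Unit => ()) fun _ => a
    rw [csum_single, csum_single] at h
    have hPeq : P = fun _ : Unit => () = () := by
      funext i; exact propext ⟨fun _ => rfl, fun _ => hP i⟩
    subst hPeq
    exact h.symm
  have h := csum_partition (K := K) (fun _ : Unit => (default : ι)) fun _ => f default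
  rw [csum_single] at h
  rw [h]
  congr 1
  funext j
  rw [key _ fun _ => Subsingleton.elim _ _, Subsingleton.elim j default]

open Classical in
/-- Countable sums as a `Summation`. -/
noncomputable def summation (K : Type*) [CommSemiring K] [CountableSums K] : Summation K where
  Dom ι := Countable ι
  sum {ι} f := if h : Countable ι then csum f else 0
  dom_of_surjective f hf h := hf.countable
  dom_of_injective f hf h := hf.countable
  sum_unique {ι} _ f := (dif_pos (inferInstance : Countable ι)).trans (csum_unique f)
  sum_fiberwise p hp h f := by
    have := hp.countable
    rw [dif_pos h, dif_pos hp.countable, csum_partition p]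
    congr 1
    funext j
    have hj : Countable {i : _ // p i = j} := inferInstance
    rw [dif_pos hj]
  mul_sum h a f := by
    rw [dif_pos h, dif_pos h, mul_csum]

theorem summation_sum {ι : Type} [h : Countable ι] (f : ι → K) : (summation K).sum f = csum f :=
  dif_pos h

end CountableSums

/-- Finite sums as a `Summation`. -/
noncomputable def finiteSummation (K : Type*) [CommSemiring K] : Summation K where
  Dom ι := Finite ι
  sum f := ∑ᶠ i, f i
  dom_of_surjective f hf h := Finite.of_surjective f hf
  dom_of_injective f hf h := Finite.of_injective f hf
  sum_unique f := finsum_unique f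
  sum_fiberwise {ι κ} p hp h f := by
    classical
    have := Finite.of_surjective p hp
    have := Fintype.ofFinite ι
    have := Fintype.ofFinite κ
    simp only [finsum_eq_sum_of_fintype]
    rw [← (Equiv.sigmaFiberEquiv p).sum_comp, Fintype.sum_sigma]
    rfl
  mul_sum {ι} h a f := by
    have := Fintype.ofFinite ι
    simp only [finsum_eq_sum_of_fintype, Finset.mul_sum]

/-! ### Leftmost derivations and derivation trees -/

namespace LIG

variable {K : Type*} {T N Γ : Type}

/-- Sentential forms whose stacks are written top first. -/
abbrev TForm (T N Γ : Type) : Type := List ((N × List Γ) ⊕ T)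

/-- The same sentential form with stacks written bottom first. -/
def TForm.toSForm (β : TForm T N Γ) : SForm T N Γ :=
  β.map (Sum.elim (fun x => .nt x.1 x.2.reverse) .tm)

/-- The sentential form given by a list of nonterminals, all with the stack `[s₀]`, and
terminals. -/
def sideForm (s₀ : Γ) (l : List (N ⊕ T)) : TForm T N Γ := l.map (Sum.map (fun Y => (Y, [s₀])) id)

/-- `Rewrites s₀ p X σ φ`: the production `p` of a top-down grammar rewrites `X` with the stack
`σ`, top first, to `φ`. -/
inductive Rewrites (s₀ : Γ) : Production T N Γ → N → List Γ → TForm T N Γ → Prop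
  | spine (X : N) (A : Γ) (ρ : List Γ) (l : List (N ⊕ T)) (X' : N) (γ : List Γ)
      (r : List (N ⊕ T)) :
      Rewrites s₀ (.spine X [A] (sideForm s₀ l).toSForm X' γ (sideForm s₀ r).toSForm) X (A :: ρ)
        (sideForm s₀ l ++ .inl (X', γ.reverse ++ ρ) :: sideForm s₀ r)
  | leaf (X : N) (A : Γ) (a : Option T) :
      Rewrites s₀ (.leaf X [A] a) X [A] (a.toList.map .inr)

/-- A family of objects, one for each nonterminal of a sentential form; `E X σ` are the objects
for `X` with the stack `σ`, top first. -/
def Forest (E : N → List Γ → Type) : TForm T N Γ → Type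
  | [] => Unit
  | .inr _ :: β => Forest E β
  | .inl x :: β => E x.1 x.2 × Forest E β

namespace Forest

variable {E : N → List Γ → Type}

/-- Concatenation of forests. -/
def append : (α : TForm T N Γ) → {β : TForm T N Γ} → Forest E α → Forest E β → Forest E (α ++ β)
  | [], _, _, g => g
  | .inr _ :: α, _, f, g => append α f g
  | .inl _ :: α, _, f, g => (f.1, append α f.2 g)

theorem append_injective (α : TForm T N Γ) {β : TForm T N Γ} {f f' : Forest E α}
    {g g' : Forest E β} (h : append α f g = append α f' g') : f = f' ∧ g = g' := by
  induction α with
  | nil => exact ⟨rfl, h⟩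
  | cons x α ih =>
    rcases x with x | a
    · obtain ⟨h1, h2⟩ := Prod.mk.inj h
      obtain ⟨h3, h4⟩ := ih h2
      exact ⟨Prod.ext h1 h3, h4⟩
    · exact ih h

theorem append_surjective (α : TForm T N Γ) {β : TForm T N Γ} (h : Forest E (α ++ β)) :
    ∃ f g, append α f g = h := by
  induction α with
  | nil => exact ⟨(), h, rfl⟩
  | cons x α ih =>
    rcases x with x | a
    · obtain ⟨f, g, hfg⟩ := ih h.2
      exact ⟨(h.1, f), g, Prod.ext rfl hfg⟩
    · exact ih h

/-- The empty family of objects for a string of terminals. -/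
def ofTerminals : (u : List T) → Forest E (u.map .inr)
  | [] => ()
  | _ :: u => ofTerminals u

theorem eq_ofTerminals (u : List T) (f : Forest E (u.map .inr)) : f = ofTerminals u := by
  induction u with
  | nil => rfl
  | cons a u ih => exact ih f

/-- The string spelled by a forest and by the terminals between its members. -/
def yield (y : ∀ {X σ}, E X σ → List T) : (β : TForm T N Γ) → Forest E β → List T
  | [], _ => []
  | .inr a :: β, f => a :: yield y β f
  | .inl _ :: β, f => y f.1 ++ yield y β f.2

/-- The product of the weights of the members of a forest. -/
def weight [CommSemiring K] (w : ∀ {X σ}, E X σ → K) : (β : TForm T N Γ) → Forest E β → K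
  | [], _ => 1
  | .inr _ :: β, f => weight w β f
  | .inl _ :: β, f => w f.1 * weight w β f.2

/-- The sum of the sizes of the members of a forest. -/
def size (z : ∀ {X σ}, E X σ → ℕ) : (β : TForm T N Γ) → Forest E β → ℕ
  | [], _ => 0
  | .inr _ :: β, f => size z β f
  | .inl _ :: β, f => z f.1 + size z β f.2

theorem yield_ofTerminals (y : ∀ {X σ}, E X σ → List T) (u : List T) :
    yield (E := E) y (u.map .inr) (ofTerminals u) = u := by
  induction u with
  | nil => rfl
  | cons a u ih => exact congrArg (a :: ·) ih

theorem weight_ofTerminals [CommSemiring K] (w : ∀ {X σ}, E X σ → K) (u : List T) :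
    weight (E := E) w (u.map .inr) (ofTerminals u) = 1 := by
  induction u with
  | nil => rfl
  | cons a u ih => exact ih

theorem size_ofTerminals (z : ∀ {X σ}, E X σ → ℕ) (u : List T) :
    size (E := E) z (u.map .inr) (ofTerminals u) = 0 := by
  induction u with
  | nil => rfl
  | cons a u ih => exact ih

theorem yield_append (y : ∀ {X σ}, E X σ → List T) (α : TForm T N Γ) {β : TForm T N Γ}
    (f : Forest E α) (g : Forest E β) :
    yield y (α ++ β) (append α f g) = yield y α f ++ yield y β g := by
  induction α with
  | nil => rfl
  | cons x α ih =>
    rcases x with x | a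
    · simp [yield, append, ih]
    · exact congrArg (a :: ·) (ih f)

theorem weight_append [CommSemiring K] (w : ∀ {X σ}, E X σ → K) (α : TForm T N Γ)
    {β : TForm T N Γ} (f : Forest E α) (g : Forest E β) :
    weight w (α ++ β) (append α f g) = weight w α f * weight w β g := by
  induction α with
  | nil => simp [weight, append]
  | cons x α ih =>
    rcases x with x | a
    · simp [weight, append, ih, mul_assoc]
    · exact ih f

theorem size_append (z : ∀ {X σ}, E X σ → ℕ) (α : TForm T N Γ) {β : TForm T N Γ}
    (f : Forest E α) (g : Forest E β) :
    size z (α ++ β) (append α f g) = size z α f + size z β g := by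
  induction α with
  | nil => simp [size, append]
  | cons x α ih =>
    rcases x with x | a
    · simp [size, append, ih, add_assoc]
    · exact ih f

end Forest

/-- One rewriting step of `X` with the stack `σ`, together with objects for the nonterminals of
the right-hand side. -/
structure Unfolding (P : Finset (Production T N Γ)) (s₀ : Γ) (E : N → List Γ → Type) (X : N)
    (σ : List Γ) where
  prod : Production T N Γ
  rhs : TForm T N Γ
  mem : prod ∈ P
  rewrites : Rewrites s₀ prod X σ rhs
  kids : Forest E rhs

/-- Abstract derivation trees of a top-down grammar: objects `E X σ` for the nonterminals `X`
with stack `σ` (top first) that correspond bijectively to a production and objects for its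
right-hand side, all of these together being smaller. -/
structure TreeModel [CommSemiring K] (P : Finset (Production T N Γ)) (s₀ : Γ)
    (δ : Production T N Γ → K) where
  E : N → List Γ → Type
  yield : ∀ {X σ}, E X σ → List T
  weight : ∀ {X σ}, E X σ → K
  size : ∀ {X σ}, E X σ → ℕ
  unfold : ∀ {X σ}, E X σ → Unfolding P s₀ E X σ
  unfold_injective : ∀ {X σ}, Function.Injective (unfold (X := X) (σ := σ))
  unfold_surjective : ∀ {X σ}, Function.Surjective (unfold (X := X) (σ := σ))
  yield_eq : ∀ {X σ} (e : E X σ), yield e = (unfold e).kids.yield yield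
  weight_eq : ∀ {X σ} (e : E X σ), weight e = δ (unfold e).prod * (unfold e).kids.weight weight
  size_lt : ∀ {X σ} (e : E X σ), (unfold e).kids.size size < size e

theorem toSForm_append (α β : TForm T N Γ) : (α ++ β).toSForm = α.toSForm ++ β.toSForm :=
  List.map_append

theorem toSForm_sideForm_injective (s₀ : Γ) :
    Function.Injective fun l : List (N ⊕ T) => (sideForm s₀ l).toSForm := by
  have h : (fun l : List (N ⊕ T) => (sideForm s₀ l).toSForm) =
      List.map (Sum.elim (fun Y => .nt Y [s₀]) .tm) := by
    funext l
    simp only [sideForm, TForm.toSForm, List.map_map]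
    congr 1
    funext x
    rcases x with x | a <;> rfl
  rw [h]
  apply List.map_injective_iff.2
  rintro (x | a) (y | b) <;> simp

/-- A production determines the result of rewriting a given nonterminal. -/
theorem Rewrites.unique {s₀ : Γ} {p : Production T N Γ} {X : N} {σ : List Γ}
    {φ φ' : TForm T N Γ} (h : Rewrites s₀ p X σ φ) (h' : Rewrites s₀ p X σ φ') : φ = φ' := by
  cases h with
  | spine _ A ρ l X' γ r =>
    generalize hL : (sideForm s₀ l).toSForm = L at h'
    generalize hR : (sideForm s₀ r).toSForm = R at h'
    cases h' with
    | spine _ _ _ l' _ _ r' =>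
      rw [toSForm_sideForm_injective s₀ hL, toSForm_sideForm_injective s₀ hR]
  | leaf _ A a => cases h'; rfl

theorem Rewrites.spine_inv {s₀ : Γ} {X X' Y : N} {A : Γ} {l r : SForm T N Γ} {γ σ : List Γ}
    {φ : TForm T N Γ} (h : Rewrites s₀ (.spine X [A] l X' γ r) Y σ φ) :
    Y = X ∧ ∃ ρ, σ = A :: ρ := by
  cases h with | spine _ _ ρ => exact ⟨rfl, ρ, rfl⟩

theorem Rewrites.leaf_inv {s₀ : Γ} {X Y : N} {A : Γ} {a : Option T} {σ : List Γ}
    {φ : TForm T N Γ} (h : Rewrites s₀ (.leaf X [A] a) Y σ φ) :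
    Y = X ∧ σ = [A] ∧ φ = a.toList.map .inr := by
  cases h
  exact ⟨rfl, rfl, rfl⟩

theorem Rewrites.leftmostStep {s₀ : Γ} {p : Production T N Γ} {X : N} {σ : List Γ}
    {φ : TForm T N Γ} (h : Rewrites s₀ p X σ φ) (u : List T) (v : SForm T N Γ) :
    LeftmostStep p (u.map .tm ++ .nt X σ.reverse :: v) (u.map .tm ++ φ.toSForm ++ v) := by
  cases h with
  | spine _ A ρ l X' γ r =>
    have := LeftmostStep.spine u v X ρ.reverse [A] (sideForm s₀ l).toSForm X' γ
      (sideForm s₀ r).toSForm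
    simpa [toSForm_append, TForm.toSForm] using this
  | leaf _ A a =>
    have := LeftmostStep.leaf u v X [A] a
    simpa [TForm.toSForm, Function.comp_def] using this

/-- The leftmost nonterminal of a sentential form is unique. -/
theorem leftmost_unique {u u' : List T} {X X' : N} {σ σ' : List Γ} {v v' : SForm T N Γ}
    (h : u.map Sym.tm ++ .nt X σ :: v = u'.map Sym.tm ++ .nt X' σ' :: v') :
    u = u' ∧ X = X' ∧ σ = σ' ∧ v = v' := by
  induction u generalizing u' with
  | nil =>
    cases u' with
    | nil => simpa [and_assoc] using h
    | cons b u' => simp at h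
  | cons a u ih =>
    cases u' with
    | nil => simp at h
    | cons b u' =>
      simp only [List.map_cons, List.cons_append, List.cons.injEq, Sym.tm.injEq] at h
      obtain ⟨h1, h2, h3, h4⟩ := ih h.2
      exact ⟨by rw [h.1, h1], h2, h3, h4⟩

/-- The side of a production of a top-down grammar is given by a list of nonterminals and
terminals. -/
theorem exists_sideForm {s₀ : Γ} (l : SForm T N Γ) (hl : ∀ Y σ, Sym.nt Y σ ∈ l → σ = [s₀]) :
    ∃ l' : List (N ⊕ T), (sideForm s₀ l').toSForm = l := by
  induction l with
  | nil => exact ⟨[], rfl⟩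
  | cons x l ih =>
    obtain ⟨l', rfl⟩ := ih fun Y σ h => hl Y σ (List.mem_cons_of_mem _ h)
    rcases x with ⟨Y, σ⟩ | a
    · exact ⟨.inl Y :: l', by rw [hl Y σ List.mem_cons_self]; rfl⟩
    · exact ⟨.inr a :: l', rfl⟩

/-- Every leftmost step of a top-down grammar is of the form described by `Rewrites`. -/
theorem exists_rewrites {s₀ : Γ} {p : Production T N Γ} (hp : WLIG.TopDownRule s₀ p)
    {u : List T} {X : N} {σ : List Γ} {v β' : SForm T N Γ}
    (h : LeftmostStep p (u.map .tm ++ .nt X σ.reverse :: v) β') :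
    ∃ φ, Rewrites s₀ p X σ φ ∧ β' = u.map .tm ++ φ.toSForm ++ v := by
  generalize hβ : u.map Sym.tm ++ .nt X σ.reverse :: v = β at h
  cases h with
  | spine u' v' X₁ ρ γ l X' γ' r =>
    obtain ⟨rfl, rfl, hσ, rfl⟩ := leftmost_unique hβ
    cases hp with
    | spine _ A _ _ _ _ hl hr =>
      obtain ⟨l, rfl⟩ := exists_sideForm l hl
      obtain ⟨r, rfl⟩ := exists_sideForm r hr
      obtain rfl : σ = A :: ρ.reverse := by
        rw [← List.reverse_reverse σ, hσ]; simp
      exact ⟨_, .spine X A ρ.reverse l X' γ' r, by simp [TForm.toSForm]⟩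
  | leaf u' v' X₁ γ a =>
    obtain ⟨rfl, rfl, hσ, rfl⟩ := leftmost_unique hβ
    cases hp with
    | leaf _ A _ =>
      obtain rfl : σ = [A] := by rw [← List.reverse_reverse σ, hσ]; simp
      exact ⟨_, .leaf X A a, by simp [TForm.toSForm, Function.comp_def]⟩

namespace TreeModel

variable [CommSemiring K] {P : Finset (Production T N Γ)} {s₀ : Γ} {δ : Production T N Γ → K}
  (M : TreeModel P s₀ δ)

/-- The leftmost derivation that expands a forest for `β` in preorder; `u` is the string of
terminals to the left of `β`. -/
def linearize (u : List T) (β : TForm T N Γ) (f : Forest M.E β) :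
    List (Production T N Γ × SForm T N Γ) :=
  match β, f with
  | [], _ => []
  | .inr a :: β, f => linearize (u ++ [a]) β f
  | .inl _ :: β, f =>
    let x := M.unfold f.1
    (x.prod, u.map .tm ++ (x.rhs ++ β).toSForm) ::
      linearize u (x.rhs ++ β) (Forest.append x.rhs x.kids f.2)
termination_by (f.size M.size, β.length)
decreasing_by
  · apply Prod.Lex.right; simp
  · apply Prod.Lex.left
    rw [Forest.size_append]
    exact Nat.add_lt_add_right (M.size_lt _) _

theorem linearize_nil (u : List T) (f : Forest M.E []) : M.linearize u [] f = [] := by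
  rw [linearize.eq_def]

theorem linearize_tm (u : List T) (a : T) (β : TForm T N Γ) (f : Forest M.E β) :
    M.linearize u (.inr a :: β) f = M.linearize (u ++ [a]) β f :=
  linearize.eq_def M u (.inr a :: β) f

theorem linearize_nt (u : List T) (X : N) (σ : List Γ) (β : TForm T N Γ) (e : M.E X σ)
    (f : Forest M.E β) :
    M.linearize u (.inl (X, σ) :: β) (e, f) =
      ((M.unfold e).prod, u.map .tm ++ ((M.unfold e).rhs ++ β).toSForm) ::
        M.linearize u ((M.unfold e).rhs ++ β) (Forest.append _ (M.unfold e).kids f) :=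
  linearize.eq_def M u (.inl (X, σ) :: β) (e, f)

theorem isDerivation_linearize (u : List T) (β : TForm T N Γ) (f : Forest M.E β) :
    IsDerivation P (u.map .tm ++ β.toSForm) (M.linearize u β f) (u ++ f.yield M.yield) := by
  induction u, β, f using linearize.induct M with
  | case1 u f => simp [linearize, IsDerivation, TForm.toSForm, Forest.yield]
  | case2 u a β f ih =>
    rw [linearize]
    simpa [TForm.toSForm, Forest.yield] using ih
  | case3 u y β f x ih =>
    rw [linearize]
    refine ⟨x.mem, ?_, ?_⟩
    · rw [toSForm_append, ← List.append_assoc]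
      exact x.rewrites.leftmostStep u _
    · rw [Forest.yield_append, ← M.yield_eq] at ih
      exact ih

theorem weight_linearize (u : List T) (β : TForm T N Γ) (f : Forest M.E β) :
    ((M.linearize u β f).map fun q => δ q.1).prod = f.weight M.weight := by
  induction u, β, f using linearize.induct M with
  | case1 u f => simp [linearize, Forest.weight]
  | case2 u a β f ih => rw [linearize]; exact ih
  | case3 u y β f x ih =>
    rw [linearize, List.map_cons, List.prod_cons, ih, Forest.weight_append, ← mul_assoc,
      ← M.weight_eq]
    rfl

/-- Two forests with the same derivation agree: the first production of the derivation determines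
the right-hand side, the rest determines the remaining forest, and unfolding is injective. -/
theorem linearize_injective (u : List T) (β : TForm T N Γ) (f g : Forest M.E β)
    (h : M.linearize u β f = M.linearize u β g) : f = g := by
  induction u, β, f using linearize.induct M with
  | case1 u f => rfl
  | case2 u a β f ih => exact ih g (by rwa [linearize, linearize] at h)
  | case3 u y β f x ih =>
    obtain ⟨e, f⟩ := f
    obtain ⟨e', g⟩ := g
    rw [linearize_nt, linearize_nt] at h
    obtain ⟨h1, h2⟩ := List.cons.inj h
    have key : M.unfold e = M.unfold e' ∧ f = g := by
      have ih' : ∀ g : Forest M.E ((M.unfold e).rhs ++ β), M.linearize u ((M.unfold e).rhs ++ β)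
        (Forest.append (M.unfold e).rhs (M.unfold e).kids f) = M.linearize u _ g →
          Forest.append (M.unfold e).rhs (M.unfold e).kids f = g := ih
      clear ih
      generalize M.unfold e = x₁ at *
      generalize M.unfold e' = x₂ at *
      obtain ⟨p, φ, hm, hr, k⟩ := x₁
      obtain ⟨p', φ', hm', hr', k'⟩ := x₂
      obtain rfl : p = p' := congrArg Prod.fst h1
      obtain rfl := hr.unique hr'
      obtain ⟨rfl, rfl⟩ := Forest.append_injective _ (ih' _ h2)
      exact ⟨rfl, rfl⟩
    obtain ⟨h3, rfl⟩ := key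
    rw [M.unfold_injective h3]

/-- Every leftmost derivation arises from a forest. -/
theorem exists_linearize_eq (hP : ∀ p ∈ P, WLIG.TopDownRule s₀ p)
    (d : List (Production T N Γ × SForm T N Γ)) (u : List T) (β : TForm T N Γ) (s : List T)
    (h : IsDerivation P (u.map .tm ++ β.toSForm) d s) :
    ∃ f, M.linearize u β f = d ∧ u ++ f.yield M.yield = s := by
  induction d generalizing u β with
  | nil =>
    induction β generalizing u with
    | nil =>
      refine ⟨(), M.linearize_nil u _, ?_⟩
      have h' : u.map Sym.tm ++ [] = s.map Sym.tm := h
      rw [List.append_nil] at h'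
      rw [← List.map_injective_iff.2 (fun a b hab => Sym.tm.inj hab) h']
      simp [Forest.yield]
    | cons x β ih =>
      rcases x with x | a
      · have h' : u.map Sym.tm ++ TForm.toSForm (.inl x :: β) = s.map Sym.tm := h
        have : Sym.nt x.1 x.2.reverse ∈ s.map (Sym.tm (N := N) (Γ := Γ)) := by
          rw [← h']; simp [TForm.toSForm]
        simp at this
      · obtain ⟨f, h1, h2⟩ := ih (u ++ [a]) (by simpa [TForm.toSForm] using h)
        exact ⟨f, by rwa [linearize_tm], by simpa [Forest.yield] using h2⟩
  | cons q d ihd =>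
    obtain ⟨p, β'⟩ := q
    induction β generalizing u with
    | nil =>
      obtain ⟨-, hs, -⟩ := h
      generalize hβ : u.map Sym.tm ++ TForm.toSForm [] = γ at hs
      have hno : ∀ Y σ, (Sym.nt Y σ : Sym T N Γ) ∉ γ := by
        intro Y σ; rw [← hβ]; simp [TForm.toSForm]
      cases hs with
      | spine _ _ X ρ γ => exact absurd (by simp) (hno X (ρ ++ γ))
      | leaf _ _ X γ => exact absurd (by simp) (hno X γ)
    | cons x β ih =>
      rcases x with ⟨X, σ⟩ | a
      · obtain ⟨hp, hs, hd⟩ := h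
        obtain ⟨φ, hφ, rfl⟩ := exists_rewrites (hP p hp) hs
        obtain ⟨g, hg1, hg2⟩ := ihd u (φ ++ β) (by
          rw [toSForm_append, ← List.append_assoc]; exact hd)
        obtain ⟨k, f, rfl⟩ := Forest.append_surjective φ g
        obtain ⟨e, he⟩ := M.unfold_surjective ⟨p, φ, hp, hφ, k⟩
        refine ⟨(e, f), ?_, ?_⟩
        · rw [linearize_nt]
          generalize M.unfold e = x₀ at he ⊢
          subst he
          rw [toSForm_append, ← List.append_assoc]
          exact congrArg _ hg1
        · rw [Forest.yield_append] at hg2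
          have := M.yield_eq e
          rw [he] at this
          change u ++ (M.yield e ++ _) = s
          rw [this]
          exact hg2
      · obtain ⟨f, h1, h2⟩ := ih (u ++ [a]) (by simpa [TForm.toSForm] using h)
        exact ⟨f, by rwa [linearize_tm], by simpa [Forest.yield] using h2⟩

/-- The trees of a tree model with root `X[s₀]` and yield `s` correspond to the leftmost
derivations of `s`. -/
theorem exists_equiv_derivations (G : WLIG K T N Γ) {s₀ : Γ} (h₀ : G.initStack = [s₀])
    (hG : ∀ p ∈ G.rules, WLIG.TopDownRule s₀ p) (M : TreeModel G.rules s₀ G.weight) (s : List T) :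
    ∃ e : {x : M.E G.start [s₀] // M.yield x = s} ≃ G.derivations s,
      ∀ x, G.derivationWeight (e x).1 = M.weight x.1 := by
  let β : TForm T N Γ := [.inl (G.start, [s₀])]
  have hβ : β.toSForm = [.nt G.start G.initStack] := by rw [h₀]; rfl
  let φ : {x : M.E G.start [s₀] // M.yield x = s} → G.derivations s := fun x =>
    ⟨M.linearize [] β (x.1, ()), by
      have h := M.isDerivation_linearize [] β (x.1, ())
      rw [hβ] at h
      have hx : [] ++ Forest.yield M.yield β (x.1, ()) = s := by simp [Forest.yield, β, x.2]
      exact (congrArg (IsDerivation G.rules _ (M.linearize [] β (x.1, ()))) hx).mp h⟩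
  refine ⟨Equiv.ofBijective φ ⟨fun x y h => ?_, fun d => ?_⟩, fun x => ?_⟩
  · exact Subtype.ext
      (congrArg Prod.fst (M.linearize_injective [] β _ _ (congrArg Subtype.val h)))
  · obtain ⟨f, h1, h2⟩ := M.exists_linearize_eq hG d.1 [] β s (by rw [hβ]; exact d.2)
    exact ⟨⟨f.1, by simpa [Forest.yield, β] using h2⟩, Subtype.ext h1⟩
  · exact (M.weight_linearize [] β _).trans (mul_one _)

end TreeModel
end LIG

/-! ### Head grammars -/

/-- A head grammar: every sort derives pairs `(u, v)` of strings, `u` to the left and `v` to the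
right of a gap.  A rule of type `leaf q o` derives `(o, ε)` from `q`; a rule of type
`side d q q₁` turns a pair `(u, v)` derived from `q₁` into `(uv, ε)` if `d` is true and into
`(ε, uv)` otherwise; a rule of type `comp q q₁ q₂` puts a pair derived from `q₂` into the gap of a
pair derived from `q₁`.  The rules of each form are given as types, the side rules have weight
`1`. -/
structure HeadGrammar (K : Type*) (T Q : Type) where
  leaf : Q → Option T → Type
  side : Bool → Q → Q → Type
  comp : Q → Q → Q → Type
  leafWeight : ∀ {q o}, leaf q o → K
  compWeight : ∀ {q q₁ q₂}, comp q q₁ q₂ → K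

namespace HeadGrammar

variable {K : Type*} {T Q : Type}

/-- Both components of a pair, joined. -/
def join (y : List T × List T) : List T := y.1 ++ y.2

/-- The pair `y'` put into the gap of the pair `y`. -/
def nest (y y' : List T × List T) : List T × List T := (y.1 ++ y'.1, y'.2 ++ y.2)

/-- A joined pair as a pair with empty right or left component. -/
def aside (d : Bool) (y : List T × List T) : List T × List T :=
  if d then (join y, []) else ([], join y)

theorem join_nest (y y' : List T × List T) : join (nest y y') = y.1 ++ join y' ++ y.2 := by
  simp [join, nest]

@[simp] theorem join_aside (d : Bool) (y : List T × List T) : join (aside d y) = join y := by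
  cases d <;> simp [join, aside]

theorem nest_eq_nil {y y' : List T × List T} :
    nest y y' = ([], []) ↔ y = ([], []) ∧ y' = ([], []) := by
  obtain ⟨u, v⟩ := y
  obtain ⟨u', v'⟩ := y'
  simp only [nest, Prod.mk.injEq, List.append_eq_nil_iff]
  tauto

theorem join_eq_nil {y : List T × List T} : join y = [] ↔ y = ([], []) := by
  simp [join, Prod.ext_iff]

theorem aside_eq_nil {d : Bool} {y : List T × List T} :
    aside d y = ([], []) ↔ y = ([], []) := by
  rw [← join_eq_nil, join_aside, join_eq_nil]

/-- Derivation trees of a head grammar. -/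
inductive Tree (H : HeadGrammar K T Q) : Q → Type
  | leaf {q : Q} {o : Option T} (r : H.leaf q o) : Tree H q
  | side {d : Bool} {q q₁ : Q} (r : H.side d q q₁) (t : Tree H q₁) : Tree H q
  | comp {q q₁ q₂ : Q} (r : H.comp q q₁ q₂) (t₁ : Tree H q₁) (t₂ : Tree H q₂) : Tree H q

variable {H : HeadGrammar K T Q}

namespace Tree

/-- The pair of strings derived by a tree. -/
def yield : {q : Q} → H.Tree q → List T × List T
  | _, .leaf (o := o) _ => (o.toList, [])
  | _, .side (d := d) _ t => aside d t.yield
  | _, .comp _ t₁ t₂ => nest t₁.yield t₂.yield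

/-- The product of the weights of the rules of a tree. -/
def weight [CommSemiring K] : {q : Q} → H.Tree q → K
  | _, .leaf r => H.leafWeight r
  | _, .side _ t => t.weight
  | _, .comp r t₁ t₂ => H.compWeight r * (t₁.weight * t₂.weight)

/-- The number of nodes of a tree. -/
def size : {q : Q} → H.Tree q → ℕ
  | _, .leaf _ => 1
  | _, .side _ t => t.size + 1
  | _, .comp _ t₁ t₂ => t₁.size + t₂.size + 1

/-- A tree that derives the pair of empty strings. -/
def Null {q : Q} (t : H.Tree q) : Prop := t.yield = ([], [])

end Tree

/-- The grammar with the sorts in `F` only. -/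
def restrict (H : HeadGrammar K T Q) (F : Set Q) : HeadGrammar K T F where
  leaf q o := H.leaf q o
  side d q q₁ := H.side d q q₁
  comp q q₁ q₂ := H.comp q q₁ q₂
  leafWeight r := H.leafWeight r
  compWeight r := H.compWeight r

/-- A set of sorts that contains, with the left-hand side of a rule, its right-hand side. -/
structure Closed (H : HeadGrammar K T Q) (F : Set Q) : Prop where
  side : ∀ {d q q₁}, H.side d q q₁ → q ∈ F → q₁ ∈ F
  comp_left : ∀ {q q₁ q₂}, H.comp q q₁ q₂ → q ∈ F → q₁ ∈ F
  comp_right : ∀ {q q₁ q₂}, H.comp q q₁ q₂ → q ∈ F → q₂ ∈ F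

namespace Tree

variable {F : Set Q}

/-- A tree of the restricted grammar as a tree of the whole grammar. -/
def ofRestrict : {q : F} → (H.restrict F).Tree q → H.Tree q
  | _, .leaf r => .leaf (H := H) r
  | _, .side r t => .side (H := H) r t.ofRestrict
  | _, .comp r t₁ t₂ => .comp (H := H) r t₁.ofRestrict t₂.ofRestrict

/-- A tree as a tree of the restricted grammar. -/
def toRestrict (hF : H.Closed F) : {q : Q} → (hq : q ∈ F) → H.Tree q → (H.restrict F).Tree ⟨q, hq⟩
  | _, _, .leaf r => .leaf (H := H.restrict F) r
  | q, hq, .side (q₁ := q₁) r t =>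
    .side (H := H.restrict F) (q := ⟨q, hq⟩) (q₁ := ⟨q₁, hF.side r hq⟩) r (t.toRestrict hF _)
  | q, hq, .comp (q₁ := q₁) (q₂ := q₂) r t₁ t₂ =>
    .comp (H := H.restrict F) (q := ⟨q, hq⟩) (q₁ := ⟨q₁, hF.comp_left r hq⟩)
      (q₂ := ⟨q₂, hF.comp_right r hq⟩) r (t₁.toRestrict hF _) (t₂.toRestrict hF _)

theorem ofRestrict_toRestrict (hF : H.Closed F) {q : Q} (hq : q ∈ F) (t : H.Tree q) :
    (t.toRestrict hF hq).ofRestrict = t := by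
  induction t with
  | leaf r => rfl
  | side r t ih => exact congrArg (Tree.side r) (ih _)
  | comp r t₁ t₂ ih₁ ih₂ => exact congrArg₂ (Tree.comp r) (ih₁ _) (ih₂ _)

theorem toRestrict_ofRestrict (hF : H.Closed F) {q : F} (t : (H.restrict F).Tree q) :
    t.ofRestrict.toRestrict hF q.2 = t := by
  induction t with
  | leaf r => rfl
  | side r t ih => exact congrArg (Tree.side (H := H.restrict F) r) ih
  | comp r t₁ t₂ ih₁ ih₂ => exact congrArg₂ (Tree.comp (H := H.restrict F) r) ih₁ ih₂

theorem yield_ofRestrict {q : F} (t : (H.restrict F).Tree q) : t.ofRestrict.yield = t.yield := by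
  induction t with
  | leaf r => rfl
  | side r t ih => exact congrArg (aside _) ih
  | comp r t₁ t₂ ih₁ ih₂ => exact congrArg₂ nest ih₁ ih₂

theorem weight_ofRestrict [CommSemiring K] {q : F} (t : (H.restrict F).Tree q) :
    t.ofRestrict.weight = t.weight := by
  induction t with
  | leaf r => rfl
  | side r t ih => exact ih
  | comp r t₁ t₂ ih₁ ih₂ => exact congrArg₂ (fun a b => H.compWeight r * (a * b)) ih₁ ih₂

end Tree

/-- Restriction to a closed set of sorts keeps the trees with roots in that set. -/
def restrictEquiv {F : Set Q} (hF : H.Closed F) {q : Q} (hq : q ∈ F) :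
    H.Tree q ≃ (H.restrict F).Tree ⟨q, hq⟩ where
  toFun t := t.toRestrict hF hq
  invFun t := t.ofRestrict
  left_inv t := t.ofRestrict_toRestrict hF hq
  right_inv t := t.toRestrict_ofRestrict hF

/-! ### Contraction of trees -/

/-- Contracted trees.  The root is unlabelled, other nodes carry their sort: `tm a` is a terminal,
`bin q₁ q₂ c₁ c₂` a composition and `emit d q c` a side rule. -/
inductive CTree (T Q : Type) : Type
  | nil
  | tm (a : T)
  | bin (q₁ q₂ : Q) (c₁ c₂ : CTree T Q)
  | emit (d : Bool) (q : Q) (c : CTree T Q)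

/-- The pair of strings derived by a contracted tree. -/
def CTree.yield : CTree T Q → List T × List T
  | .nil => ([], [])
  | .tm a => ([a], [])
  | .bin _ _ c₁ c₂ => nest c₁.yield c₂.yield
  | .emit d _ c => aside d c.yield

/-- The number of nodes of a contracted tree, where a terminal counts twice. -/
def CTree.size : CTree T Q → ℕ
  | .nil => 1
  | .tm _ => 2
  | .bin _ _ c₁ c₂ => c₁.size + c₂.size + 1
  | .emit _ _ c => c.size + 1

open Classical in
/-- Removal of the null subtrees and of the unary nodes that remain.  In pair mode, `m = true`,
the derived pair counts; in string mode, `m = false`, only its join counts, so that side rules are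
unary as well.  The inner of two composed trees inherits the mode, the outer one is in pair
mode.  The result is meaningful for trees that are not null. -/
noncomputable def Tree.contract : (m : Bool) → {q : Q} → H.Tree q → CTree T Q
  | _, _, .leaf (o := some a) _ => .tm a
  | _, _, .leaf (o := none) _ => .nil
  | true, _, .side (d := d) (q₁ := q₁) _ t => .emit d q₁ (t.contract false)
  | false, _, .side _ t => t.contract false
  | m, _, .comp (q₁ := q₁) (q₂ := q₂) _ t₁ t₂ =>
    if t₁.Null then t₂.contract m else
    if t₂.Null then t₁.contract m else
    .bin q₁ q₂ (t₁.contract true) (t₂.contract m)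

/-- In pair mode contraction preserves the derived pair, in string mode its join. -/
theorem yield_contract {q : Q} (t : H.Tree q) :
    (t.contract true).yield = t.yield ∧ join (t.contract false).yield = join t.yield := by
  induction t with
  | @leaf q o r => cases o <;> exact ⟨rfl, rfl⟩
  | side r t ih =>
    simp only [Tree.contract, CTree.yield, Tree.yield, join_aside, ih.2, and_true]
    simp only [aside, ih.2]
  | comp r t₁ t₂ ih₁ ih₂ =>
    simp only [Tree.contract, Tree.yield]
    by_cases h₁ : t₁.Null
    · simp only [h₁, if_true, ih₂]
      rw [Tree.Null] at h₁
      simp [h₁, nest]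
    by_cases h₂ : t₂.Null
    · simp only [h₁, h₂, if_true, if_false, ih₁]
      rw [Tree.Null] at h₂
      simp [h₂, nest]
    simp only [h₁, h₂, if_false, CTree.yield, join_nest, ih₁, ih₂, and_self]

/-- The labels of a branching or terminal node that a unary path can end in. -/
inductive Shape (T Q : Type) : Type
  | tm (a : T)
  | bin (q₁ q₂ : Q)
  | emit (d : Bool) (q : Q)

variable (H) in
/-- The unary paths that start in a node of sort `q` in mode `m`, pass along null siblings and, in
string mode, side rules, and end with a rule of the given shape. -/
inductive UnaryPath : Bool → Q → Shape T Q → Type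
  | tm {m q a} (r : H.leaf q (some a)) : UnaryPath m q (.tm a)
  | bin {m q q₁ q₂} (r : H.comp q q₁ q₂) : UnaryPath m q (.bin q₁ q₂)
  | emit {q d q₁} (r : H.side d q q₁) : UnaryPath true q (.emit d q₁)
  | right {m q q₁ q₂ sh} (r : H.comp q q₁ q₂) (t : H.Tree q₁) (ht : t.Null)
      (k : UnaryPath m q₂ sh) : UnaryPath m q sh
  | left {m q q₁ q₂ sh} (r : H.comp q q₁ q₂) (t : H.Tree q₂) (ht : t.Null)
      (k : UnaryPath m q₁ sh) : UnaryPath m q sh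
  | side {q d q₁ sh} (r : H.side d q q₁) (k : UnaryPath false q₁ sh) : UnaryPath false q sh

variable (H) in
/-- The trees of sort `q` that are not null. -/
abbrev NNTree (q : Q) : Type := {t : H.Tree q // ¬ t.Null}

variable (H) in
/-- The subtrees below the end of a unary path of the given shape. -/
abbrev Kids : Shape T Q → Type
  | .tm _ => Unit
  | .bin q₁ q₂ => H.NNTree q₁ × H.NNTree q₂
  | .emit _ q => H.NNTree q

/-- The product of the weights of the subtrees. -/
def Kids.weight [CommSemiring K] : {sh : Shape T Q} → H.Kids sh → K
  | .tm _, _ => 1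
  | .bin _ _, x => x.1.1.weight * x.2.1.weight
  | .emit _ _, x => x.1.weight

/-- The contraction of a tree whose unary path ends in the given shape, with given subtrees. -/
noncomputable def Kids.contract (m : Bool) : {sh : Shape T Q} → H.Kids sh → CTree T Q
  | .tm a, _ => .tm a
  | .bin q₁ q₂, x => .bin q₁ q₂ (x.1.1.contract true) (x.2.1.contract m)
  | .emit d q, x => .emit d q (x.1.contract false)

namespace UnaryPath

/-- The product of the weights of the rules and of the null siblings of a unary path. -/
def weight [CommSemiring K] : {m : Bool} → {q : Q} → {sh : Shape T Q} → H.UnaryPath m q sh → K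
  | _, _, _, .tm r => H.leafWeight r
  | _, _, _, .bin r => H.compWeight r
  | _, _, _, .emit _ => 1
  | _, _, _, .right r t _ k => H.compWeight r * (t.weight * k.weight)
  | _, _, _, .left r t _ k => H.compWeight r * (k.weight * t.weight)
  | _, _, _, .side _ k => k.weight

/-- The tree that consists of a unary path and the subtrees below its end. -/
def plug : {m : Bool} → {q : Q} → {sh : Shape T Q} → H.UnaryPath m q sh → H.Kids sh → H.Tree q
  | _, _, _, .tm r, _ => .leaf r
  | _, _, _, .bin r, x => .comp r x.1.1 x.2.1
  | _, _, _, .emit r, x => .side r x.1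
  | _, _, _, .right r t _ k, x => .comp r t (k.plug x)
  | _, _, _, .left r t _ k, x => .comp r (k.plug x) t
  | _, _, _, .side r k, x => .side r (k.plug x)

variable {m : Bool} {q : Q} {sh : Shape T Q}

theorem not_null_plug (k : H.UnaryPath m q sh) (x : H.Kids sh) : ¬ (k.plug x).Null := by
  induction k with
  | tm r => simp [plug, Tree.Null, Tree.yield]
  | bin r => exact fun h => x.1.2 (nest_eq_nil.1 h).1
  | emit r => exact fun h => x.2 (aside_eq_nil.1 h)
  | right r t ht k ih => exact fun h => ih x (nest_eq_nil.1 h).2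
  | left r t ht k ih => exact fun h => ih x (nest_eq_nil.1 h).1
  | side r k ih => exact fun h => ih x (aside_eq_nil.1 h)

theorem weight_plug [CommSemiring K] (k : H.UnaryPath m q sh) (x : H.Kids sh) :
    (k.plug x).weight = k.weight * x.weight := by
  induction k with
  | tm r => simp [plug, Tree.weight, weight, Kids.weight]
  | bin r => simp [plug, Tree.weight, weight, Kids.weight]
  | emit r => simp [plug, Tree.weight, weight, Kids.weight]
  | right r t ht k ih => simp [plug, Tree.weight, weight, ih, mul_assoc]
  | left r t ht k ih =>
    simp only [plug, Tree.weight, weight, ih]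
    ring
  | side r k ih => simp [plug, Tree.weight, weight, ih]

theorem contract_plug (k : H.UnaryPath m q sh) (x : H.Kids sh) :
    (k.plug x).contract m = x.contract m := by
  induction k with
  | tm r => simp [plug, Tree.contract, Kids.contract]
  | @bin m q q₁ q₂ r =>
    simp [plug, Tree.contract, Kids.contract, x.1.2, x.2.2]
  | emit r => simp [plug, Tree.contract, Kids.contract]
  | right r t ht k ih => simp [plug, Tree.contract, ih, ht]
  | left r t ht k ih => simp [plug, Tree.contract, ih, ht, k.not_null_plug]
  | side r k ih => simp [plug, Tree.contract, ih]

/-- A tree that is not null starts with a unary path in each of the modes. -/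
theorem exists_plug_eq (m : Bool) (t : H.Tree q) (ht : ¬ t.Null) :
    ∃ (sh : Shape T Q) (k : H.UnaryPath m q sh) (x : H.Kids sh), k.plug x = t := by
  induction t generalizing m with
  | @leaf q o r =>
    cases o with
    | none => exact absurd rfl ht
    | some a => exact ⟨_, .tm r, (), rfl⟩
  | side r t ih =>
    have ht' : ¬ t.Null := fun h => ht (aside_eq_nil.2 h)
    cases m with
    | true => exact ⟨_, .emit r, ⟨t, ht'⟩, rfl⟩
    | false =>
      obtain ⟨sh, k, x, rfl⟩ := ih false ht'
      exact ⟨_, .side r k, x, rfl⟩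
  | comp r t₁ t₂ ih₁ ih₂ =>
    by_cases h₁ : t₁.Null
    · obtain ⟨sh, k, x, rfl⟩ := ih₂ m fun h => ht (nest_eq_nil.2 ⟨h₁, h⟩)
      exact ⟨_, .right r t₁ h₁ k, x, rfl⟩
    by_cases h₂ : t₂.Null
    · obtain ⟨sh, k, x, rfl⟩ := ih₁ m h₁
      exact ⟨_, .left r t₂ h₂ k, x, rfl⟩
    exact ⟨_, .bin r, (⟨t₁, h₁⟩, ⟨t₂, h₂⟩), rfl⟩

/-- The unary path of a tree and the subtrees below its end are unique: along the path, one of the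
two subtrees of every composition is null and the other one is not, and at the end neither is. -/
theorem plug_injective (k : H.UnaryPath m q sh) (x : H.Kids sh)
    (z : Σ sh, H.UnaryPath m q sh × H.Kids sh) (h : k.plug x = z.2.1.plug z.2.2) :
    ⟨sh, k, x⟩ = z := by
  obtain ⟨sh', k', x'⟩ := z
  dsimp only at h
  induction k generalizing sh' with
  | tm r =>
    cases k' <;> cases h
    rfl
  | bin r =>
    obtain ⟨⟨t₁, h₁⟩, ⟨t₂, h₂⟩⟩ := x
    cases k' <;> try (cases h; done)
    · obtain ⟨⟨t₁', h₁'⟩, ⟨t₂', h₂'⟩⟩ := x'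
      cases h; rfl
    · cases h; contradiction
    · cases h; contradiction
  | emit r =>
    cases k' <;> try cases h
    obtain ⟨t, ht⟩ := x
    obtain ⟨t', ht'⟩ := x'
    cases h; rfl
  | right r t ht k ih =>
    cases k' <;> try (cases h; done)
    · obtain ⟨⟨t₁', h₁'⟩, ⟨t₂', h₂'⟩⟩ := x'
      cases h; contradiction
    · simp only [plug, Tree.comp.injEq] at h
      obtain ⟨rfl, rfl, h1, h2, h3⟩ := h
      cases h1
      cases h2
      cases ih _ _ _ _ (eq_of_heq h3)
      rfl
    · simp only [plug, Tree.comp.injEq] at h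
      obtain ⟨rfl, rfl, -, h2, -⟩ := h
      cases h2
      exact absurd ht (not_null_plug _ _)
  | left r t ht k ih =>
    cases k' <;> try (cases h; done)
    · obtain ⟨⟨t₁', h₁'⟩, ⟨t₂', h₂'⟩⟩ := x'
      cases h; contradiction
    · simp only [plug, Tree.comp.injEq] at h
      obtain ⟨rfl, rfl, -, -, h3⟩ := h
      cases h3
      exact absurd ht (not_null_plug _ _)
    · simp only [plug, Tree.comp.injEq] at h
      obtain ⟨rfl, rfl, h1, h2, h3⟩ := h
      cases h1
      cases h3
      cases ih _ _ _ _ (eq_of_heq h2)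
      rfl
  | side r k ih =>
    cases k' <;> try cases h
    simp only [plug, Tree.side.injEq] at h
    obtain ⟨rfl, rfl, h1, h2⟩ := h
    cases h1
    cases ih _ _ _ _ (eq_of_heq h2)
    rfl

end UnaryPath

variable (H) in
/-- The trees that are not null and have a given contraction. -/
abbrev Fiber (m : Bool) (q : Q) (c : CTree T Q) : Type :=
  {t : H.Tree q // ¬ t.Null ∧ t.contract m = c}

section Fiber

variable {m : Bool} {q : Q}

theorem isEmpty_fiber_nil : IsEmpty (H.Fiber m q .nil) := by
  refine ⟨fun ⟨t, ht, hc⟩ => ?_⟩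
  obtain ⟨sh, k, x, rfl⟩ := UnaryPath.exists_plug_eq m t ht
  rw [k.contract_plug] at hc
  cases sh <;> cases hc

variable (H m q) in
/-- The trees that contract to a terminal are the unary paths that end in it. -/
noncomputable def fiberTm (a : T) : H.UnaryPath m q (.tm a) ≃ H.Fiber m q (.tm a) :=
  Equiv.ofBijective (fun k => ⟨k.plug (), k.not_null_plug _, k.contract_plug _⟩) <| by
    refine ⟨fun k k' h => ?_, fun ⟨t, ht, hc⟩ => ?_⟩
    · have := UnaryPath.plug_injective k () ⟨_, k', ()⟩ (congrArg Subtype.val h)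
      cases this
      rfl
    · obtain ⟨sh, k, x, rfl⟩ := UnaryPath.exists_plug_eq m t ht
      rw [k.contract_plug] at hc
      cases sh <;> cases hc
      exact ⟨k, rfl⟩

variable (H m q) in
/-- The trees that contract to a side rule are made of a unary path and a subtree. -/
noncomputable def fiberEmit (d : Bool) (q₁ : Q) (c : CTree T Q) :
    H.UnaryPath m q (.emit d q₁) × H.Fiber false q₁ c ≃ H.Fiber m q (.emit d q₁ c) :=
  Equiv.ofBijective (fun x => ⟨x.1.plug ⟨x.2.1, x.2.2.1⟩, x.1.not_null_plug _, by
      rw [x.1.contract_plug, Kids.contract, x.2.2.2]⟩) <| by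
    refine ⟨fun x y h => ?_, fun ⟨t, ht, hc⟩ => ?_⟩
    · obtain ⟨k, t, ht⟩ := x
      obtain ⟨k', t', ht'⟩ := y
      have := UnaryPath.plug_injective k ⟨t, ht.1⟩ ⟨_, k', ⟨t', ht'.1⟩⟩ (congrArg Subtype.val h)
      cases this
      rfl
    · obtain ⟨sh, k, x, rfl⟩ := UnaryPath.exists_plug_eq m t ht
      rw [k.contract_plug] at hc
      cases sh <;> cases hc
      exact ⟨(k, ⟨x.1, x.2, rfl⟩), rfl⟩

variable (H m q) in
/-- The trees that contract to a composition are made of a unary path and two subtrees. -/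
noncomputable def fiberBin (q₁ q₂ : Q) (c₁ c₂ : CTree T Q) :
    H.UnaryPath m q (.bin q₁ q₂) × (H.Fiber true q₁ c₁ × H.Fiber m q₂ c₂) ≃
      H.Fiber m q (.bin q₁ q₂ c₁ c₂) :=
  Equiv.ofBijective (fun x => ⟨x.1.plug (⟨x.2.1.1, x.2.1.2.1⟩, ⟨x.2.2.1, x.2.2.2.1⟩),
      x.1.not_null_plug _, (x.1.contract_plug _).trans
        (congrArg₂ (CTree.bin q₁ q₂) x.2.1.2.2 x.2.2.2.2)⟩) <| by
    refine ⟨fun x y h => ?_, fun ⟨t, ht, hc⟩ => ?_⟩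
    · obtain ⟨k, ⟨t₁, ht₁⟩, ⟨t₂, ht₂⟩⟩ := x
      obtain ⟨k', ⟨t₁', ht₁'⟩, ⟨t₂', ht₂'⟩⟩ := y
      have := UnaryPath.plug_injective k (⟨t₁, ht₁.1⟩, ⟨t₂, ht₂.1⟩)
        ⟨_, k', (⟨t₁', ht₁'.1⟩, ⟨t₂', ht₂'.1⟩)⟩ (congrArg Subtype.val h)
      cases this
      rfl
    · obtain ⟨sh, k, x, rfl⟩ := UnaryPath.exists_plug_eq m t ht
      rw [k.contract_plug] at hc
      cases sh <;> cases hc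
      exact ⟨(k, ⟨x.1.1, x.1.2, rfl⟩, ⟨x.2.1, x.2.2, rfl⟩), rfl⟩

variable [CommSemiring K] (S : Summation K)

variable (H) in
/-- The weight of a contracted tree with root sort `q` in mode `m`: every node contributes the sum
of the weights of all unary paths that lead to it from the position where its parent was. -/
noncomputable def contractedWeight : Bool → Q → CTree T Q → K
  | _, _, .nil => 0
  | m, q, .tm a => S.sum fun k : H.UnaryPath m q (.tm a) => k.weight
  | m, q, .bin q₁ q₂ c₁ c₂ => (S.sum fun k : H.UnaryPath m q (.bin q₁ q₂) => k.weight) *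
      (contractedWeight true q₁ c₁ * contractedWeight m q₂ c₂)
  | m, q, .emit d q₁ c => (S.sum fun k : H.UnaryPath m q (.emit d q₁) => k.weight) *
      contractedWeight false q₁ c

/-- The weights of all trees with a given contraction sum up to the weight of the contraction.
Since the fibre is a product of a set of unary paths and of smaller fibres, none of them empty, all
of these inherit from it that sums over them are meaningful. -/
theorem sum_fiber (c : CTree T Q) (m : Bool) (q : Q) (hne : Nonempty (H.Fiber m q c))
    (hd : S.Dom (H.Fiber m q c)) :
    (S.sum fun t : H.Fiber m q c => t.1.weight) = H.contractedWeight S m q c := by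
  induction c generalizing m q with
  | nil => exact (isEmpty_fiber_nil.false hne.some).elim
  | tm a =>
    refine (S.sum_equiv (H.fiberTm m q a) (S.dom_equiv (H.fiberTm m q a).symm hd) _ _
      fun k => ?_).symm
    exact (k.weight_plug ()).trans (mul_one _)
  | bin q₁ q₂ c₁ c₂ ih₁ ih₂ =>
    have hd' := S.dom_equiv (H.fiberBin m q q₁ q₂ c₁ c₂).symm hd
    obtain ⟨k, t₁, t₂⟩ := (H.fiberBin m q q₁ q₂ c₁ c₂).symm hne.some
    have : Nonempty (H.UnaryPath m q (.bin q₁ q₂)) := ⟨k⟩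
    have : Nonempty (H.Fiber true q₁ c₁) := ⟨t₁⟩
    have : Nonempty (H.Fiber m q₂ c₂) := ⟨t₂⟩
    have hd₁₂ := S.dom_of_surjective Prod.snd Prod.snd_surjective hd'
    rw [contractedWeight, ← ih₁ _ _ ⟨t₁⟩ (S.dom_of_surjective Prod.fst Prod.fst_surjective hd₁₂),
      ← ih₂ _ _ ⟨t₂⟩ (S.dom_of_surjective Prod.snd Prod.snd_surjective hd₁₂),
      ← S.sum_mul_sum hd₁₂, ← S.sum_mul_sum hd']
    exact (S.sum_equiv (H.fiberBin m q q₁ q₂ c₁ c₂) hd' _ _ fun x => x.1.weight_plug _).symm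
  | emit d q₁ c ih =>
    have hd' := S.dom_equiv (H.fiberEmit m q d q₁ c).symm hd
    obtain ⟨k, t⟩ := (H.fiberEmit m q d q₁ c).symm hne.some
    have : Nonempty (H.UnaryPath m q (.emit d q₁)) := ⟨k⟩
    have : Nonempty (H.Fiber false q₁ c) := ⟨t⟩
    rw [contractedWeight, ← ih _ _ ⟨t⟩ (S.dom_of_surjective Prod.snd Prod.snd_surjective hd'),
      ← S.sum_mul_sum hd']
    exact (S.sum_equiv (H.fiberEmit m q d q₁ c) hd' _ _ fun x => x.1.weight_plug _).symm

end Fiber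

end HeadGrammar

/-! ### The head grammar of a top-down grammar -/

namespace LIG

/-- The sorts of the head grammar of a top-down grammar.  `seq x γ y` stands for the part of a
trunk, with the trees to its left and right, from the state `x` with `γ` (top first) on top of the
stack to the state `y` at the moment when `γ` has been popped; the state `none` means that the
trunk has ended with a leaf production.  `lst β` stands for a list of side trees and terminals, all
to the left of the gap, and `right r` for such a list to the right of the gap; `item Y` and
`term a` stand for its members.  `core r X γ z` is `seq (some X) γ z` followed by `right r`, and
`wrap l r X γ z` is `core r X γ z` preceded by `lst l`. -/
inductive Srt (T N Γ : Type) : Type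
  | seq (x : Option N) (γ : List Γ) (y : Option N)
  | lst (β : List (N ⊕ T))
  | wrap (l r : List (N ⊕ T)) (X : N) (γ : List Γ) (z : Option N)
  | core (r : List (N ⊕ T)) (X : N) (γ : List Γ) (z : Option N)
  | right (r : List (N ⊕ T))
  | item (Y : N)
  | term (a : T)

variable {K : Type*} {T N Γ : Type}

section Rules

variable (P : Finset (Production T N Γ)) (s₀ : Γ)

/-- The leaf rules of the head grammar of a top-down grammar.  A leaf production ends a trunk only
if it consumes the whole stack, so that no symbol may follow `A` in `last`. -/
inductive LeafRule : Srt T N Γ → Option T → Type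
  | term (a : T) : LeafRule (.term a) (some a)
  | lstNil : LeafRule (.lst []) none
  | done (x : Option N) : LeafRule (.seq x [] x) none
  | last (X : N) (A : Γ) (o : Option T) (h : .leaf X [A] o ∈ P) :
    LeafRule (.seq (some X) [A] none) o

/-- The side rules of the head grammar of a top-down grammar. -/
inductive SideRule : Bool → Srt T N Γ → Srt T N Γ → Type
  | item (Y : N) : SideRule true (.item Y) (.seq (some Y) [s₀] none)
  | right (r : List (N ⊕ T)) : SideRule false (.right r) (.lst r)

/-- The composition rules of the head grammar of a top-down grammar.  In `run`, a production
replaces the top symbol `A` by `γ`; the trunk is cut at the moment when `γ` has been popped, in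
the state `z`. -/
inductive CompRule : Srt T N Γ → Srt T N Γ → Srt T N Γ → Type
  | lstNt (Y : N) (β : List (N ⊕ T)) : CompRule (.lst (.inl Y :: β)) (.item Y) (.lst β)
  | lstTm (a : T) (β : List (N ⊕ T)) : CompRule (.lst (.inr a :: β)) (.term a) (.lst β)
  | core (r : List (N ⊕ T)) (X : N) (γ : List Γ) (z : Option N) :
    CompRule (.core r X γ z) (.right r) (.seq (some X) γ z)
  | wrap (l r : List (N ⊕ T)) (X : N) (γ : List Γ) (z : Option N) :
    CompRule (.wrap l r X γ z) (.lst l) (.core r X γ z)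
  | run (X : N) (A : Γ) (σ : List Γ) (y : Option N) (l : List (N ⊕ T)) (X' : N) (γ : List Γ)
      (r : List (N ⊕ T)) (z : Option N)
      (h : .spine X [A] (sideForm s₀ l).toSForm X' γ (sideForm s₀ r).toSForm ∈ P) :
    CompRule (.seq (some X) (A :: σ) y) (.wrap l r X' γ.reverse z) (.seq z σ y)

/-- The weight of a leaf rule. -/
def LeafRule.weight [One K] (δ : Production T N Γ → K) :
    {q : Srt T N Γ} → {o : Option T} → LeafRule P q o → K
  | _, _, .term _ => 1
  | _, _, .lstNil => 1
  | _, _, .done _ => 1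
  | _, _, .last X A o _ => δ (.leaf X [A] o)

/-- The weight of a composition rule. -/
def CompRule.weight [One K] (δ : Production T N Γ → K) :
    {q q₁ q₂ : Srt T N Γ} → CompRule P s₀ q q₁ q₂ → K
  | _, _, _, .lstNt _ _ => 1
  | _, _, _, .lstTm _ _ => 1
  | _, _, _, .core _ _ _ _ => 1
  | _, _, _, .wrap _ _ _ _ _ => 1
  | _, _, _, .run X A _ _ l X' γ r _ _ =>
    δ (.spine X [A] (sideForm s₀ l).toSForm X' γ (sideForm s₀ r).toSForm)

/-- The head grammar of a top-down grammar.  A sort derives the pairs of strings to the left and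
to the right of the corresponding part of a trunk. -/
abbrev headGrammar [One K] (δ : Production T N Γ → K) : HeadGrammar K T (Srt T N Γ) where
  leaf := LeafRule P
  side := SideRule s₀
  comp := CompRule P s₀
  leafWeight r := r.weight P δ
  compWeight r := r.weight P s₀ δ

end Rules

open HeadGrammar

variable [CommSemiring K] {P : Finset (Production T N Γ)} {s₀ : Γ} {δ : Production T N Γ → K}

/-- The trees for a nonterminal with a given stack. -/
abbrev TrunkTree (P : Finset (Production T N Γ)) (s₀ : Γ) (δ : Production T N Γ → K) (X : N)
    (σ : List Γ) : Type :=
  (headGrammar P s₀ δ).Tree (.seq (some X) σ none)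

/-- The forest of the nonterminals of a list. -/
def toForest : (β : List (N ⊕ T)) → (headGrammar P s₀ δ).Tree (.lst β) →
    Forest (TrunkTree P s₀ δ) (sideForm s₀ β)
  | [], _ => ()
  | .inr _ :: β, .comp (.lstTm _ _) _ t => toForest β t
  | .inl _ :: β, .comp (.lstNt _ _) (.side (.item _) e) t => (e, toForest β t)

/-- The three parts of a tree for a right-hand side. -/
def unwrap {l r : List (N ⊕ T)} {X : N} {γ : List Γ} {z : Option N} :
    (headGrammar P s₀ δ).Tree (.wrap l r X γ z) → (headGrammar P s₀ δ).Tree (.lst l) ×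
      (headGrammar P s₀ δ).Tree (.seq (some X) γ z) × (headGrammar P s₀ δ).Tree (.lst r)
  | .comp (.wrap _ _ _ _ _) t₁ (.comp (.core _ _ _ _) (.side (.right _) t₂) t) => (t₁, t, t₂)

/-- The concatenation of a run that pops `γ` and a run that pops `ρ`. -/
def joinSeq : {x : Option N} → {γ : List Γ} → {z : Option N} → {ρ : List Γ} → {y : Option N} →
    (headGrammar P s₀ δ).Tree (.seq x γ z) → (headGrammar P s₀ δ).Tree (.seq z ρ y) →
    (headGrammar P s₀ δ).Tree (.seq x (γ ++ ρ) y)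
  | _, [], _, _, _, .leaf (.done _), s => s
  | _, _ :: _, _, _, _, .leaf (.last X A o h), .leaf (.done _) => .leaf (.last X A o h)
  | _, _ :: _, _, _, _, .comp (.run X A _ _ l X' γ r z h) t₁ t₂, s =>
    .comp (.run X A _ _ l X' γ r z h) t₁ (joinSeq t₂ s)

theorem joinSeq_comp {X : N} {A : Γ} {σ : List Γ} {y : Option N} {l : List (N ⊕ T)} {X' : N}
    {γ : List Γ} {r : List (N ⊕ T)} {z : Option N}
    {h : .spine X [A] (sideForm s₀ l).toSForm X' γ (sideForm s₀ r).toSForm ∈ P} {ρ : List Γ}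
    {y' : Option N} (t₁ : (headGrammar P s₀ δ).Tree (.wrap l r X' γ.reverse z))
    (t₂ : (headGrammar P s₀ δ).Tree (.seq z σ y)) (s : (headGrammar P s₀ δ).Tree (.seq y ρ y')) :
    joinSeq (.comp (.run X A σ y l X' γ r z h) t₁ t₂) s =
      .comp (.run X A (σ ++ ρ) y' l X' γ r z h) t₁ (joinSeq t₂ s) := rfl

/-- The production at the root of a trunk tree, with trees for its right-hand side. -/
def unfoldTrunk {X : N} : {σ : List Γ} → TrunkTree P s₀ δ X σ →
    Unfolding P s₀ (TrunkTree P s₀ δ) X σ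
  | _, .leaf (.last _ A o h) => ⟨_, _, h, .leaf X A o, Forest.ofTerminals o.toList⟩
  | _, .comp (.run _ A σ _ l X' γ r _ h) t₁ t₂ =>
    ⟨_, _, h, .spine X A σ l X' γ r, Forest.append _ (toForest l (unwrap t₁).1)
      (joinSeq (unwrap t₁).2.1 t₂, toForest r (unwrap t₁).2.2)⟩

/-- The tree of a list whose nonterminals have given trees. -/
def ofForest : (β : List (N ⊕ T)) → Forest (TrunkTree P s₀ δ) (sideForm s₀ β) →
    (headGrammar P s₀ δ).Tree (.lst β)
  | [], _ => .leaf .lstNil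
  | .inr a :: β, f => .comp (.lstTm a β) (.leaf (.term a)) (ofForest β f)
  | .inl Y :: β, f => .comp (.lstNt Y β) (.side (.item Y) f.1) (ofForest β f.2)

theorem toForest_ofForest : (β : List (N ⊕ T)) →
    (f : Forest (TrunkTree P s₀ δ) (sideForm s₀ β)) → toForest β (ofForest β f) = f
  | [], _ => rfl
  | .inr _ :: β, f => toForest_ofForest β f
  | .inl _ :: β, f => Prod.ext rfl (toForest_ofForest β f.2)

theorem ofForest_toForest : (β : List (N ⊕ T)) → (t : (headGrammar P s₀ δ).Tree (.lst β)) →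
    ofForest β (toForest β t) = t
  | [], .leaf .lstNil => rfl
  | .inr _ :: β, .comp (.lstTm _ _) (.leaf (.term _)) t =>
    congrArg (Tree.comp _ _) (ofForest_toForest β t)
  | .inl _ :: β, .comp (.lstNt _ _) (.side (.item _) _) t =>
    congrArg (Tree.comp _ _) (ofForest_toForest β t)

/-- The tree for a right-hand side with given parts. -/
def wrapUp {l r : List (N ⊕ T)} {X : N} {γ : List Γ} {z : Option N}
    (t : (headGrammar P s₀ δ).Tree (.lst l) × (headGrammar P s₀ δ).Tree (.seq (some X) γ z) ×
      (headGrammar P s₀ δ).Tree (.lst r)) : (headGrammar P s₀ δ).Tree (.wrap l r X γ z) :=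
  .comp (.wrap _ _ _ _ _) t.1 (.comp (.core _ _ _ _) (.side (.right _) t.2.2) t.2.1)

theorem wrapUp_unwrap {l r : List (N ⊕ T)} {X : N} {γ : List Γ} {z : Option N} :
    (t : (headGrammar P s₀ δ).Tree (.wrap l r X γ z)) → wrapUp (unwrap t) = t
  | .comp (.wrap _ _ _ _ _) _ (.comp (.core _ _ _ _) (.side (.right _) _) _) => rfl

/-- The decomposition of a run that is a single leaf. -/
def splitLeaf {x : Option N} {A : Γ} {o : Option T} : (γ : List Γ) → {ρ : List Γ} →
    {y : Option N} → LeafRule P (.seq x (A :: (γ ++ ρ)) y) o →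
    Σ z, (headGrammar P s₀ δ).Tree (.seq x (A :: γ) z) × (headGrammar P s₀ δ).Tree (.seq z ρ y)
  | [], [], _, .last X A o h => ⟨none, .leaf (.last X A o h), .leaf (.done none)⟩

/-- The decomposition of a run that pops `γ` and `ρ` at the point where `γ` has been popped. -/
def splitSeq : {x : Option N} → (γ : List Γ) → {ρ : List Γ} → {y : Option N} →
    (headGrammar P s₀ δ).Tree (.seq x (γ ++ ρ) y) →
    Σ z, (headGrammar P s₀ δ).Tree (.seq x γ z) × (headGrammar P s₀ δ).Tree (.seq z ρ y)
  | x, [], _, _, t => ⟨x, .leaf (.done x), t⟩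
  | _, _ :: γ, _, _, .leaf r => splitLeaf γ r
  | _, _ :: γ, _, _, .comp (.run X A _ _ l X' γ' r z h) t₁ t₂ =>
    ⟨(splitSeq γ t₂).1, .comp (.run X A γ _ l X' γ' r z h) t₁ (splitSeq γ t₂).2.1,
      (splitSeq γ t₂).2.2⟩

theorem joinSeq_splitSeq : {x : Option N} → (γ : List Γ) → {ρ : List Γ} → {y : Option N} →
    (t : (headGrammar P s₀ δ).Tree (.seq x (γ ++ ρ) y)) →
    joinSeq (splitSeq γ t).2.1 (splitSeq γ t).2.2 = t
  | _, [], _, _, _ => rfl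
  | _, [_], [], _, .leaf (.last _ _ _ _) => rfl
  | _, _ :: γ, _, _, .comp (.run _ _ _ _ _ _ _ _ _ _) _ t₂ =>
    (joinSeq_comp _ _ _).trans (congrArg (Tree.comp _ _) (joinSeq_splitSeq γ t₂))

theorem splitSeq_joinSeq : {x : Option N} → {γ : List Γ} → {z : Option N} → {ρ : List Γ} →
    {y : Option N} → (t : (headGrammar P s₀ δ).Tree (.seq x γ z)) →
    (s : (headGrammar P s₀ δ).Tree (.seq z ρ y)) → splitSeq γ (joinSeq t s) = ⟨z, t, s⟩
  | _, [], _, _, _, .leaf (.done _), _ => rfl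
  | _, _ :: _, _, _, _, .leaf (.last _ _ _ _), .leaf (.done _) => rfl
  | _, _ :: γ, z, ρ, y, .comp (.run X A _ _ l X' γ' r z' h) t₁ t₂, s =>
    congrArg (fun w : Σ z, (headGrammar P s₀ δ).Tree (.seq z' γ z) ×
        (headGrammar P s₀ δ).Tree (.seq z ρ y) =>
      (⟨w.1, .comp (.run X A γ _ l X' γ' r z' h) t₁ w.2.1, w.2.2⟩ :
        Σ z, (headGrammar P s₀ δ).Tree (.seq (some X) (A :: γ) z) ×
          (headGrammar P s₀ δ).Tree (.seq z ρ y))) (splitSeq_joinSeq t₂ s)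

theorem yield_lst : (β : List (N ⊕ T)) → (t : (headGrammar P s₀ δ).Tree (.lst β)) →
    t.yield = ((toForest β t).yield (fun e => HeadGrammar.join e.yield), [])
  | [], .leaf .lstNil => rfl
  | .inr _ :: β, .comp (.lstTm _ _) (.leaf (.term _)) t => by
    rw [Tree.yield, yield_lst β t]; rfl
  | .inl _ :: β, .comp (.lstNt _ _) (.side (.item _) _) t => by
    rw [Tree.yield, yield_lst β t]; rfl

theorem weight_lst : (β : List (N ⊕ T)) → (t : (headGrammar P s₀ δ).Tree (.lst β)) →
    t.weight = (toForest β t).weight (fun e => e.weight)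
  | [], .leaf .lstNil => rfl
  | .inr _ :: β, .comp (.lstTm _ _) (.leaf (.term _)) t => by
    rw [Tree.weight, weight_lst β t]
    exact (one_mul _).trans (one_mul _)
  | .inl _ :: β, .comp (.lstNt _ _) (.side (.item _) _) t => by
    rw [Tree.weight, weight_lst β t]
    exact one_mul _

theorem size_lst : (β : List (N ⊕ T)) → (t : (headGrammar P s₀ δ).Tree (.lst β)) →
    (toForest β t).size (fun e => e.size) ≤ t.size
  | [], .leaf .lstNil => Nat.zero_le _
  | .inr _ :: β, .comp (.lstTm _ _) (.leaf (.term _)) t => by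
    exact (size_lst β t).trans (by simp only [Tree.size]; omega)
  | .inl _ :: β, .comp (.lstNt _ _) (.side (.item _) e) t => by
    exact (Nat.add_le_add_left (size_lst β t) e.size).trans (by simp only [Tree.size]; omega)

theorem yield_joinSeq : {x : Option N} → {γ : List Γ} → {z : Option N} → {ρ : List Γ} →
    {y : Option N} → (t : (headGrammar P s₀ δ).Tree (.seq x γ z)) →
    (s : (headGrammar P s₀ δ).Tree (.seq z ρ y)) → (joinSeq t s).yield = nest t.yield s.yield
  | _, [], _, _, _, .leaf (.done _), s => by simp [joinSeq, Tree.yield, nest]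
  | _, _ :: _, _, _, _, .leaf (.last _ _ _ _), .leaf (.done _) => by
    simp [joinSeq, Tree.yield, nest]
  | _, _ :: _, _, _, _, .comp (.run _ _ _ _ _ _ _ _ _ _) _ t₂, s => by
    rw [joinSeq_comp]
    simp [Tree.yield, nest, yield_joinSeq t₂ s]

theorem weight_joinSeq : {x : Option N} → {γ : List Γ} → {z : Option N} → {ρ : List Γ} →
    {y : Option N} → (t : (headGrammar P s₀ δ).Tree (.seq x γ z)) →
    (s : (headGrammar P s₀ δ).Tree (.seq z ρ y)) → (joinSeq t s).weight = t.weight * s.weight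
  | _, [], _, _, _, .leaf (.done _), _ => (one_mul _).symm
  | _, _ :: _, _, _, _, .leaf (.last _ _ _ _), .leaf (.done _) => (mul_one _).symm
  | _, _ :: _, _, _, _, .comp (.run _ _ _ _ _ _ _ _ _ _) _ t₂, s => by
    rw [joinSeq_comp]
    simp only [Tree.weight, weight_joinSeq t₂ s, mul_assoc]
    rfl

theorem size_joinSeq : {x : Option N} → {γ : List Γ} → {z : Option N} → {ρ : List Γ} →
    {y : Option N} → (t : (headGrammar P s₀ δ).Tree (.seq x γ z)) →
    (s : (headGrammar P s₀ δ).Tree (.seq z ρ y)) → (joinSeq t s).size < t.size + s.size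
  | _, [], _, _, _, .leaf (.done _), s => by simp [joinSeq, Tree.size]
  | _, _ :: _, _, _, _, .leaf (.last _ _ _ _), .leaf (.done _) => by simp [joinSeq, Tree.size]
  | _, _ :: _, _, _, _, .comp (.run _ _ _ _ _ _ _ _ _ _) _ t₂, s => by
    have := size_joinSeq t₂ s
    rw [joinSeq_comp]
    simp only [Tree.size]
    omega

theorem unfoldTrunk_surjective {X : N} {σ : List Γ} :
    Function.Surjective (unfoldTrunk (P := P) (s₀ := s₀) (δ := δ) (X := X) (σ := σ)) := by
  rintro ⟨p, φ, hp, hφ, k⟩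
  cases hφ with
  | leaf _ A o =>
    obtain rfl := Forest.eq_ofTerminals o.toList k
    exact ⟨.leaf (.last X A o hp), rfl⟩
  | spine _ A ρ l X' γ r =>
    obtain ⟨f, ⟨c, g⟩, rfl⟩ := Forest.append_surjective (sideForm s₀ l) k
    refine ⟨.comp (.run X A ρ none l X' γ r _ hp) (wrapUp (ofForest l f,
      (splitSeq γ.reverse c).2.1, ofForest r g)) (splitSeq γ.reverse c).2.2, ?_⟩
    have key : ∀ f' c' g', f' = f → c' = c → g' = g →
        (⟨_, _, hp, .spine X A ρ l X' γ r, Forest.append _ f' (c', g')⟩ :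
          Unfolding P s₀ (TrunkTree P s₀ δ) X (A :: ρ)) =
        ⟨_, _, hp, .spine X A ρ l X' γ r, Forest.append _ f (c, g)⟩ := by
      rintro _ _ _ rfl rfl rfl
      rfl
    exact key _ _ _ (toForest_ofForest l f) (joinSeq_splitSeq _ c) (toForest_ofForest r g)

theorem unfoldTrunk_injective {X : N} : {σ : List Γ} → (t t' : TrunkTree P s₀ δ X σ) →
    unfoldTrunk t = unfoldTrunk t' → t = t'
  | _, .leaf (.last _ A o h), .leaf (.last _ _ o' h'), ht => by
    cases congrArg Unfolding.prod ht
    rfl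
  | _, .leaf (.last _ _ _ _), .comp (.run _ _ _ _ _ _ _ _ _ _) _ _, ht => by
    cases congrArg Unfolding.prod ht
  | _, .comp (.run _ _ _ _ _ _ _ _ _ _) _ _, .leaf (.last _ _ _ _), ht => by
    cases congrArg Unfolding.prod ht
  | _, .comp (.run _ A σ _ l X' γ r z h) t₁ t₂, .comp (.run _ _ _ _ l' X'' γ' r' z' h') t₁' t₂',
      ht => by
    have hp : Production.spine X [A] (sideForm s₀ l).toSForm X' γ (sideForm s₀ r).toSForm =
        .spine X [A] (sideForm s₀ l').toSForm X'' γ' (sideForm s₀ r').toSForm :=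
      congrArg Unfolding.prod ht
    simp only [Production.spine.injEq, true_and] at hp
    obtain ⟨hl, rfl, rfl, hr⟩ := hp
    obtain rfl := toSForm_sideForm_injective s₀ hl
    obtain rfl := toSForm_sideForm_injective s₀ hr
    have hk := eq_of_heq (Unfolding.mk.inj ht).2.2
    obtain ⟨h1, h2⟩ := Forest.append_injective _ hk
    obtain ⟨h3, h4⟩ := Prod.mk.inj h2
    have h5 := congrArg (splitSeq γ.reverse) h3
    rw [splitSeq_joinSeq, splitSeq_joinSeq] at h5
    obtain ⟨rfl, h6⟩ := Sigma.mk.inj h5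
    obtain ⟨h7, rfl⟩ := Prod.mk.inj (eq_of_heq h6)
    have h8 : unwrap t₁ = unwrap t₁' := Prod.ext
      (by rw [← ofForest_toForest l (unwrap t₁).1, h1, ofForest_toForest])
      (Prod.ext h7 (by rw [← ofForest_toForest r (unwrap t₁).2.2, h4, ofForest_toForest]))
    rw [← wrapUp_unwrap t₁, h8, wrapUp_unwrap]

theorem yield_unfoldTrunk {X : N} : {σ : List Γ} → (t : TrunkTree P s₀ δ X σ) →
    HeadGrammar.join t.yield =
      (unfoldTrunk t).kids.yield (fun e => HeadGrammar.join e.yield)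
  | _, .leaf (.last _ A o h) => by
    refine Eq.trans ?_ (Forest.yield_ofTerminals _ o.toList).symm
    simp [Tree.yield, HeadGrammar.join]
  | _, .comp (.run _ A σ _ l X' γ r _ h) (.comp (.wrap _ _ _ _ _) tl (.comp (.core _ _ _ _)
      (.side (.right _) tr) tc)) t₂ => by
    refine Eq.trans ?_ (Forest.yield_append _ (sideForm s₀ l) _ _).symm
    simp only [Forest.yield]
    rw [yield_joinSeq]
    simp only [Tree.yield, yield_lst, unwrap, nest, aside, HeadGrammar.join]
    simp

theorem weight_unfoldTrunk {X : N} : {σ : List Γ} → (t : TrunkTree P s₀ δ X σ) →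
    t.weight = δ (unfoldTrunk t).prod * (unfoldTrunk t).kids.weight (fun e => e.weight)
  | _, .leaf (.last _ A o h) => by
    refine Eq.trans ?_ (congrArg _ (Forest.weight_ofTerminals _ o.toList).symm)
    exact (mul_one _).symm
  | _, .comp (.run _ A σ _ l X' γ r _ h) (.comp (.wrap _ _ _ _ _) tl (.comp (.core _ _ _ _)
      (.side (.right _) tr) tc)) t₂ => by
    refine Eq.trans ?_ (congrArg (δ (.spine X [A] (sideForm s₀ l).toSForm X' γ
      (sideForm s₀ r).toSForm) * ·) (Forest.weight_append _ (sideForm s₀ l) _ _).symm)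
    simp only [Forest.weight]
    rw [weight_joinSeq]
    simp only [Tree.weight, weight_lst, unwrap, CompRule.weight]
    ring

theorem size_unfoldTrunk {X : N} : {σ : List Γ} → (t : TrunkTree P s₀ δ X σ) →
    (unfoldTrunk t).kids.size (fun e => e.size) < t.size
  | _, .leaf (.last _ A o h) => by
    refine lt_of_eq_of_lt (Forest.size_ofTerminals _ o.toList) ?_
    simp [Tree.size]
  | _, .comp (.run _ A σ _ l X' γ r _ h) (.comp (.wrap _ _ _ _ _) tl (.comp (.core _ _ _ _)
      (.side (.right _) tr) tc)) t₂ => by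
    refine lt_of_eq_of_lt (Forest.size_append _ (sideForm s₀ l) _ _) ?_
    have h1 := size_lst l tl
    have h2 := size_lst r tr
    have h3 := size_joinSeq tc t₂
    refine lt_of_le_of_lt (Nat.add_le_add h1 (Nat.add_le_add h3.le h2)) ?_
    simp only [Tree.size]
    omega

variable (P s₀ δ) in
/-- The trunk trees are the derivation trees of a top-down grammar. -/
def trunkModel : TreeModel P s₀ δ where
  E := TrunkTree P s₀ δ
  yield t := HeadGrammar.join t.yield
  weight t := t.weight
  size t := t.size
  unfold := unfoldTrunk
  unfold_injective h := unfoldTrunk_injective _ _ h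
  unfold_surjective := unfoldTrunk_surjective
  yield_eq := yield_unfoldTrunk
  weight_eq := weight_unfoldTrunk
  size_lt := size_unfoldTrunk

/-- The sorts whose lists are of length at most `n`. -/
def boundedSorts (T N Γ : Type) (n : ℕ) : Set (Srt T N Γ) := {q | match q with
  | .seq _ γ _ => γ.length ≤ n
  | .lst β => β.length ≤ n
  | .wrap l r _ γ _ => l.length ≤ n ∧ r.length ≤ n ∧ γ.length ≤ n
  | .core r _ γ _ => r.length ≤ n ∧ γ.length ≤ n
  | .right r => r.length ≤ n
  | .item _ => True
  | .term _ => True}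

theorem finite_boundedSorts [Finite T] [Finite N] [Finite Γ] (n : ℕ) :
    (boundedSorts T N Γ n).Finite := by
  have hΓ := List.finite_length_le Γ n
  have hβ := List.finite_length_le (N ⊕ T) n
  have h : (boundedSorts T N Γ n) ⊆
      (fun x : Option N × List Γ × Option N => .seq x.1 x.2.1 x.2.2) ''
        (Set.univ ×ˢ {γ | γ.length ≤ n} ×ˢ Set.univ) ∪
      (Srt.lst '' {β | β.length ≤ n}) ∪
      (fun x : List (N ⊕ T) × List (N ⊕ T) × N × List Γ × Option N =>
        .wrap x.1 x.2.1 x.2.2.1 x.2.2.2.1 x.2.2.2.2) ''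
        ({β | β.length ≤ n} ×ˢ {β | β.length ≤ n} ×ˢ Set.univ ×ˢ {γ | γ.length ≤ n} ×ˢ Set.univ) ∪
      (fun x : List (N ⊕ T) × N × List Γ × Option N => .core x.1 x.2.1 x.2.2.1 x.2.2.2) ''
        ({β | β.length ≤ n} ×ˢ Set.univ ×ˢ {γ | γ.length ≤ n} ×ˢ Set.univ) ∪
      (Srt.right '' {β | β.length ≤ n}) ∪ Set.range Srt.item ∪ Set.range Srt.term := by
    rintro (⟨x, γ, y⟩ | β | ⟨l, r, X, γ, z⟩ | ⟨r, X, γ, z⟩ | r | Y | a) hq <;>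
      simp_all [boundedSorts]
  refine Set.Finite.subset ?_ h
  have u1 := Set.finite_univ (α := Option N)
  have u2 := Set.finite_univ (α := N)
  exact (((((((u1.prod (hΓ.prod u1)).image _).union (hβ.image _)).union
    ((hβ.prod (hβ.prod (u2.prod (hΓ.prod u1)))).image _)).union
    ((hβ.prod (u2.prod (hΓ.prod u1))).image _)).union (hβ.image _)).union
    (Set.finite_range _)).union (Set.finite_range _)

/-- The number of symbols on the right-hand side of a production, apart from the nonterminal that
continues the trunk. -/
def rhsLength : Production T N Γ → ℕ
  | .spine _ _ l _ γ r => l.length + γ.length + r.length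
  | .leaf _ _ _ => 0

/-- Lists of sorts only get shorter, except where a production introduces its right-hand side. -/
theorem closed_boundedSorts {n : ℕ} (hn : 1 ≤ n) (hP : ∀ p ∈ P, rhsLength p ≤ n) :
    (headGrammar P s₀ δ).Closed (boundedSorts T N Γ n) where
  side r hq := by
    cases r with
    | item Y => exact hn
    | right r => exact hq
  comp_left r hq := by
    cases r with
    | lstNt Y β => trivial
    | lstTm a β => trivial
    | core r X γ z => exact hq.1
    | wrap l r X γ z => exact hq.1
    | run X A σ y l X' γ r z h =>
      have := hP _ h
      simp only [rhsLength, TForm.toSForm, sideForm, List.length_map] at this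
      exact ⟨by omega, by omega, by rw [List.length_reverse]; omega⟩
  comp_right r hq := by
    cases r with
    | lstNt Y β => exact Nat.le_of_succ_le hq
    | lstTm a β => exact Nat.le_of_succ_le hq
    | core r X γ z => exact hq.2
    | wrap l r X γ z => exact hq.2
    | run X A σ y l X' γ r z h => exact Nat.le_of_succ_le hq

/-- Every top-down grammar has a head grammar with finitely many sorts, whose trees correspond to
the leftmost derivations. -/
theorem exists_headGrammar [Finite T] [Finite N] [Finite Γ] (G : WLIG K T N Γ)
    (hG : G.IsTopDown) :
    ∃ (Q : Type) (_ : Finite Q) (H : HeadGrammar K T Q) (q₀ : Q), ∀ s,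
      ∃ e : G.derivations s ≃ {t : H.Tree q₀ // HeadGrammar.join t.yield = s},
        ∀ d, (e d).1.weight = G.derivationWeight d.1 := by
  obtain ⟨s₀, h₀, hG⟩ := hG
  -- the additional `1` provides for the initial stack, which has one symbol
  let n := G.rules.sup rhsLength + 1
  let F := boundedSorts T N Γ n
  have hF : (headGrammar G.rules s₀ G.weight).Closed F :=
    closed_boundedSorts (Nat.le_add_left 1 _) fun p hp =>
      (Finset.le_sup (f := rhsLength) hp).trans (Nat.le_add_right _ 1)
  have hq : (.seq (some G.start) [s₀] none) ∈ F := Nat.le_add_left 1 _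
  refine ⟨F, (finite_boundedSorts n).to_subtype, (headGrammar G.rules s₀ G.weight).restrict F,
    ⟨_, hq⟩, fun s => ?_⟩
  obtain ⟨e, he⟩ := TreeModel.exists_equiv_derivations G h₀ hG (trunkModel G.rules s₀ G.weight) s
  let e' := restrictEquiv hF hq
  have hy : ∀ t, (e' t).yield = t.yield := fun t => by
    rw [← Tree.yield_ofRestrict]
    exact congrArg Tree.yield (e'.symm_apply_apply t)
  have hw : ∀ t, (e' t).weight = t.weight := fun t => by
    rw [← Tree.weight_ofRestrict]
    exact congrArg Tree.weight (e'.symm_apply_apply t)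
  refine ⟨e.symm.trans (e'.subtypeEquiv
    (p := fun t : TrunkTree G.rules s₀ G.weight G.start [s₀] => HeadGrammar.join t.yield = s)
    (q := fun t : ((headGrammar G.rules s₀ G.weight).restrict F).Tree ⟨_, hq⟩ =>
      HeadGrammar.join t.yield = s) fun t => by rw [hy]), fun d => ?_⟩
  obtain ⟨x, rfl⟩ := e.surjective d
  rw [he]
  exact (hw _).trans (congrArg (fun x => Tree.weight x.1) (e.symm_apply_apply x))

end LIG

/-! ### The normal form grammar -/

namespace HeadGrammar

/-- The nonterminals of the normal form grammar: `str q` starts a trunk that derives the joins of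
the nonempty pairs of `q`, `pre a` derives the terminal `a`, and `main` is the state in which all
trunks continue. -/
inductive NT (T Q : Type) : Type
  | start
  | main
  | str (q : Q)
  | pre (a : T)

/-- The stack symbols of the normal form grammar: the initial symbol and sorts with a mode. -/
inductive SS (Q : Type) : Type
  | bot
  | sy (m : Bool) (q : Q)

instance {T Q : Type} [Finite T] [Finite Q] : Finite (NT T Q) := by
  refine Finite.of_injective (β := Bool ⊕ Q ⊕ T) (fun x => match x with
    | .start => .inl false
    | .main => .inl true
    | .str q => .inr (.inl q)
    | .pre a => .inr (.inr a)) ?_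
  rintro (_ | _ | _ | _) (_ | _ | _ | _) <;> simp

instance {Q : Type} [Finite Q] : Finite (SS Q) := by
  refine Finite.of_injective (β := Option (Bool × Q)) (fun x => match x with
    | .bot => none
    | .sy m q => some (m, q)) ?_
  rintro (_ | _) (_ | _) <;> simp

variable {K : Type*} {T Q : Type}

/-- `Bottom q₀ Z A q`: the nonterminal `Z` with the stack `[A]` stands for the sort `q` in string
mode. -/
inductive Bottom (q₀ : Q) : NT T Q → SS Q → Q → Prop
  | start : Bottom q₀ .start .bot q₀
  | str (q : Q) : Bottom q₀ (.str q) .bot q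
  | main (q : Q) : Bottom q₀ .main (.sy false q) q

/-- The sort that a nonterminal stands for if a given symbol is on top of its stack. -/
def topSort (q₀ : Q) : NT T Q → SS Q → Q
  | .str q, _ => q
  | .main, .sy _ q => q
  | _, _ => q₀

theorem Bottom.topSort_eq {q₀ : Q} {Z : NT T Q} {A : SS Q} {q : Q} (h : Bottom q₀ Z A q) :
    topSort q₀ Z A = q := by
  cases h <;> rfl

variable {H : HeadGrammar K T Q}

theorem nonempty_fiber_tm {m : Bool} {q : Q} {a : T} :
    Nonempty (H.Fiber m q (.tm a)) ↔ Nonempty (H.UnaryPath m q (.tm a)) :=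
  (H.fiberTm m q a).nonempty_congr.symm

theorem nonempty_fiber_bin {m : Bool} {q q₁ q₂ : Q} {c₁ c₂ : CTree T Q} :
    Nonempty (H.Fiber m q (.bin q₁ q₂ c₁ c₂)) ↔ Nonempty (H.UnaryPath m q (.bin q₁ q₂)) ∧
      Nonempty (H.Fiber true q₁ c₁) ∧ Nonempty (H.Fiber m q₂ c₂) := by
  rw [← (H.fiberBin m q q₁ q₂ c₁ c₂).nonempty_congr, nonempty_prod, nonempty_prod]

theorem nonempty_fiber_emit {m : Bool} {d : Bool} {q q₁ : Q} {c : CTree T Q} :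
    Nonempty (H.Fiber m q (.emit d q₁ c)) ↔ Nonempty (H.UnaryPath m q (.emit d q₁)) ∧
      Nonempty (H.Fiber false q₁ c) := by
  rw [← (H.fiberEmit m q d q₁ c).nonempty_congr, nonempty_prod]

theorem UnaryPath.mode_eq_of_emit {m : Bool} {q : Q} {sh : Shape T Q} (k : H.UnaryPath m q sh)
    {d : Bool} {q₁ : Q} (h : sh = .emit d q₁) : m = true := by
  induction k with
  | tm r => cases h
  | bin r => cases h
  | emit r => rfl
  | right r t ht k ih => exact ih h
  | left r t ht k ih => exact ih h
  | side r k ih => cases ih h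

theorem not_nonempty_fiber_nil {m : Bool} {q : Q} : ¬ Nonempty (H.Fiber m q .nil) :=
  not_nonempty_iff.2 isEmpty_fiber_nil

/-- In string mode, side rules are unary. -/
theorem not_nonempty_fiber_emit {d : Bool} {q q₁ : Q} {c : CTree T Q} :
    ¬ Nonempty (H.Fiber false q (.emit d q₁ c)) := fun h => by
  obtain ⟨k⟩ := (nonempty_fiber_emit.1 h).1
  cases k.mode_eq_of_emit rfl

variable (H) (q₀ : Q)

/-- The productions of the normal form grammar.  A production is included only if some unary path
has the corresponding shape, so that no derivations arise that do not come from a tree.  The sort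
on top of the stack is the outermost of the pairs that are still to be derived. -/
inductive IsRule : Production T (NT T Q) (SS Q) → Prop
  | pre (a : T) : IsRule (.leaf (.pre a) [.bot] (some a))
  | empty (h : Nonempty {t : H.Tree q₀ // t.Null}) : IsRule (.leaf .start [.bot] none)
  | strTm {Z : NT T Q} {A : SS Q} {q : Q} (hZ : Bottom q₀ Z A q) {a : T}
      (h : Nonempty (H.UnaryPath false q (.tm a))) : IsRule (.leaf Z [A] (some a))
  | strBin {Z : NT T Q} {A : SS Q} {q : Q} (hZ : Bottom q₀ Z A q) {q₁ q₂ : Q}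
      (h : Nonempty (H.UnaryPath false q (.bin q₁ q₂))) :
      IsRule (.spine Z [A] [] .main [.sy false q₂, .sy true q₁] [])
  | pairTm {q : Q} {a : T} (h : Nonempty (H.UnaryPath true q (.tm a))) :
      IsRule (.spine .main [.sy true q] [.nt (.pre a) [.bot]] .main [] [])
  | pairBin {q q₁ q₂ : Q} (h : Nonempty (H.UnaryPath true q (.bin q₁ q₂))) :
      IsRule (.spine .main [.sy true q] [] .main [.sy true q₂, .sy true q₁] [])
  | pairLeft {q q₁ : Q} (h : Nonempty (H.UnaryPath true q (.emit true q₁))) :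
      IsRule (.spine .main [.sy true q] [.nt (.str q₁) [.bot]] .main [] [])
  | pairRight {q q₁ : Q} (h : Nonempty (H.UnaryPath true q (.emit false q₁))) :
      IsRule (.spine .main [.sy true q] [] .main [] [.nt (.str q₁) [.bot]])

theorem finite_isRule [Finite T] [Finite Q] : {p | H.IsRule q₀ p}.Finite := by
  refine Set.Finite.subset ?_ (s :=
    Set.range (fun x : NT T Q × SS Q × Option T => Production.leaf x.1 [x.2.1] x.2.2) ∪
    Set.range (fun x : NT T Q × SS Q × Bool × Q × Q =>
      Production.spine x.1 [x.2.1] [] .main [.sy x.2.2.1 x.2.2.2.1, .sy true x.2.2.2.2] []) ∪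
    Set.range (fun x : Q × NT T Q =>
      Production.spine .main [.sy true x.1] [.nt x.2 [.bot]] .main [] []) ∪
    Set.range (fun x : Q × NT T Q =>
      Production.spine .main [.sy true x.1] [] .main [] [.nt x.2 [.bot]])) ?_
  · exact (((Set.finite_range _).union (Set.finite_range _)).union (Set.finite_range _)).union
      (Set.finite_range _)
  · rintro p (_ | _ | _ | _ | _ | _ | _ | _) <;> simp

/-- The productions of the normal form grammar, as a finite set. -/
noncomputable def ruleSet [Finite T] [Finite Q] : Finset (Production T (NT T Q) (SS Q)) :=
  (H.finite_isRule q₀).toFinset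

theorem mem_ruleSet [Finite T] [Finite Q] {p : Production T (NT T Q) (SS Q)} :
    p ∈ H.ruleSet q₀ ↔ H.IsRule q₀ p :=
  (H.finite_isRule q₀).mem_toFinset

/-- The derivation trees of the normal form grammar: a stack (top first) of sorts in pair mode
above a bottom symbol is expanded by one contracted tree for each of its symbols. -/
inductive Obj : NT T Q → List (SS Q) → Type
  | pre (a : T) : Obj (.pre a) [.bot]
  | empty (h : Nonempty {t : H.Tree q₀ // t.Null}) : Obj .start [.bot]
  | str {Z : NT T Q} {A : SS Q} {q : Q} (hZ : Bottom q₀ Z A q) (c : CTree T Q)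
      (hc : Nonempty (H.Fiber false q c)) : Obj Z [A]
  | pair {q : Q} {ρ : List (SS Q)} (c : CTree T Q) (hc : Nonempty (H.Fiber true q c))
      (s : Obj .main ρ) : Obj .main (.sy true q :: ρ)

variable {H q₀}

/-- The unfolding given by a spine production of the normal form grammar. -/
def spineUnfolding [Finite T] [Finite Q] {Z : NT T Q} {A : SS Q} {ρ : List (SS Q)}
    (l : List (NT T Q ⊕ T)) {X : NT T Q} (γ : List (SS Q)) (r : List (NT T Q ⊕ T))
    (h : H.IsRule q₀ (.spine Z [A] (sideForm .bot l).toSForm X γ (sideForm .bot r).toSForm))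
    (k : Forest (H.Obj q₀) (sideForm .bot l ++ .inl (X, γ.reverse ++ ρ) :: sideForm .bot r)) :
    Unfolding (H.ruleSet q₀) .bot (H.Obj q₀) Z (A :: ρ) :=
  ⟨_, _, (H.mem_ruleSet q₀).2 h, .spine _ _ ρ l _ γ r, k⟩

namespace Obj

/-- The string derived by a tree: the pairs of the stack symbols are nested, the topmost being the
outermost. -/
def yield : {Z : NT T Q} → {σ : List (SS Q)} → H.Obj q₀ Z σ → List T
  | _, _, .pre a => [a]
  | _, _, .empty _ => []
  | _, _, .str _ c _ => join c.yield
  | _, _, .pair c _ s => c.yield.1 ++ s.yield ++ c.yield.2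

/-- The size of a tree. -/
def size : {Z : NT T Q} → {σ : List (SS Q)} → H.Obj q₀ Z σ → ℕ
  | _, _, .pre _ => 1
  | _, _, .empty _ => 1
  | _, _, .str _ c _ => c.size
  | _, _, .pair c _ s => c.size + s.size

variable [Finite T] [Finite Q]

/-- The production at the root of a tree, with trees for its right-hand side. -/
def unfold : {Z : NT T Q} → {σ : List (SS Q)} → H.Obj q₀ Z σ →
    Unfolding (H.ruleSet q₀) .bot (H.Obj q₀) Z σ
  | _, _, .pre a => ⟨_, _, (H.mem_ruleSet q₀).2 (.pre a), .leaf _ _ _, ()⟩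
  | _, _, .empty h => ⟨_, _, (H.mem_ruleSet q₀).2 (.empty h), .leaf _ _ _, ()⟩
  | _, _, .str hZ (.tm _) hc =>
    ⟨_, _, (H.mem_ruleSet q₀).2 (.strTm hZ (nonempty_fiber_tm.1 hc)), .leaf _ _ _, ()⟩
  | _, _, .str hZ (.bin q₁ q₂ c₁ c₂) hc =>
    have h := nonempty_fiber_bin.1 hc
    spineUnfolding [] [.sy false q₂, .sy true q₁] [] (.strBin hZ h.1)
      (Obj.pair c₁ h.2.1 (.str (.main q₂) c₂ h.2.2), ())
  | _, _, .str _ .nil hc => (not_nonempty_fiber_nil hc).elim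
  | _, _, .str _ (.emit _ _ _) hc => (not_nonempty_fiber_emit hc).elim
  | _, _, .pair .nil hc _ => (not_nonempty_fiber_nil hc).elim
  | _, _, .pair (.tm a) hc s =>
    spineUnfolding [.inl (.pre a)] [] [] (.pairTm (nonempty_fiber_tm.1 hc)) (Obj.pre a, s, ())
  | _, _, .pair (.bin q₁ q₂ c₁ c₂) hc s =>
    have h := nonempty_fiber_bin.1 hc
    spineUnfolding [] [.sy true q₂, .sy true q₁] [] (.pairBin h.1)
      (Obj.pair c₁ h.2.1 (.pair c₂ h.2.2 s), ())
  | _, _, .pair (.emit true q₁ c) hc s =>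
    have h := nonempty_fiber_emit.1 hc
    spineUnfolding [.inl (.str q₁)] [] [] (.pairLeft h.1) (Obj.str (.str q₁) c h.2, s, ())
  | _, _, .pair (.emit false q₁ c) hc s =>
    have h := nonempty_fiber_emit.1 hc
    spineUnfolding [] [] [.inl (.str q₁)] (.pairRight h.1) (s, Obj.str (.str q₁) c h.2, ())

/-- Every production with trees for its right-hand side is the root of a tree; the stack pushed by a
binary production forces the shape of the tree for the continued trunk. -/
theorem unfold_surjective {Z : NT T Q} {σ : List (SS Q)} :
    Function.Surjective (unfold (H := H) (q₀ := q₀) (Z := Z) (σ := σ)) := by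
  rintro ⟨p, φ, hp, hφ, k⟩
  cases (H.mem_ruleSet q₀).1 hp with
  | pre a =>
    obtain ⟨rfl, rfl, rfl⟩ := hφ.leaf_inv
    exact ⟨.pre a, rfl⟩
  | empty h =>
    obtain ⟨rfl, rfl, rfl⟩ := hφ.leaf_inv
    exact ⟨.empty h, rfl⟩
  | @strTm _ _ _ hZ a h =>
    obtain ⟨rfl, rfl, rfl⟩ := hφ.leaf_inv
    exact ⟨.str hZ (.tm a) (nonempty_fiber_tm.2 h), rfl⟩
  | @strBin _ A q hZ q₁ q₂ h =>
    obtain ⟨rfl, ρ, rfl⟩ := hφ.spine_inv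
    obtain rfl := hφ.unique (.spine _ A ρ [] _ _ [])
    obtain ⟨x, y⟩ := k
    change H.Obj q₀ .main (.sy true q₁ :: .sy false q₂ :: ρ) at x
    cases x with
    | pair c₁ hc₁ x =>
      cases x with
      | str hZ₂ c₂ hc₂ =>
        cases hZ₂
        exact ⟨.str hZ (.bin q₁ q₂ c₁ c₂) (nonempty_fiber_bin.2 ⟨h, hc₁, hc₂⟩), rfl⟩
  | @pairTm q a h =>
    obtain ⟨rfl, ρ, rfl⟩ := hφ.spine_inv
    obtain rfl := hφ.unique (.spine _ _ ρ [.inl (NT.pre a)] _ _ [])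
    obtain ⟨x, s, y⟩ := k
    change H.Obj q₀ (.pre a) [.bot] at x
    change H.Obj q₀ .main ρ at s
    have hx : x = .pre a := by
      cases x with
      | pre a => rfl
      | str hZ => cases hZ
    subst hx
    exact ⟨.pair (.tm a) (nonempty_fiber_tm.2 h) s, rfl⟩
  | @pairBin q q₁ q₂ h =>
    obtain ⟨rfl, ρ, rfl⟩ := hφ.spine_inv
    obtain rfl := hφ.unique (.spine _ _ ρ [] _ _ [])
    obtain ⟨x, y⟩ := k
    change H.Obj q₀ .main (.sy true q₁ :: .sy true q₂ :: ρ) at x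
    cases x with
    | pair c₁ hc₁ x =>
      cases x with
      | pair c₂ hc₂ s => exact ⟨.pair (.bin q₁ q₂ c₁ c₂) (nonempty_fiber_bin.2 ⟨h, hc₁, hc₂⟩) s, rfl⟩
      | str hZ => cases hZ
  | @pairLeft q q₁ h =>
    obtain ⟨rfl, ρ, rfl⟩ := hφ.spine_inv
    obtain rfl := hφ.unique (.spine _ _ ρ [.inl (NT.str q₁)] _ _ [])
    obtain ⟨x, s, y⟩ := k
    change H.Obj q₀ (.str q₁) [.bot] at x
    change H.Obj q₀ .main ρ at s
    cases x with
    | str hZ c hc =>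
      cases hZ
      exact ⟨.pair (.emit true q₁ c) (nonempty_fiber_emit.2 ⟨h, hc⟩) s, rfl⟩
  | @pairRight q q₁ h =>
    obtain ⟨rfl, ρ, rfl⟩ := hφ.spine_inv
    obtain rfl := hφ.unique (.spine _ _ ρ [] _ _ [.inl (NT.str q₁)])
    obtain ⟨s, x, y⟩ := k
    change H.Obj q₀ (.str q₁) [.bot] at x
    change H.Obj q₀ .main ρ at s
    cases x with
    | str hZ c hc =>
      cases hZ
      exact ⟨.pair (.emit false q₁ c) (nonempty_fiber_emit.2 ⟨h, hc⟩) s, rfl⟩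

theorem unfold_injective {Z : NT T Q} {σ : List (SS Q)} :
    Function.Injective (unfold (H := H) (q₀ := q₀) (Z := Z) (σ := σ)) := by
  intro x y h
  cases x with
  | pre a =>
    cases y with
    | pre => rfl
    | str hZ => cases hZ
  | empty _ =>
    cases y with
    | empty => rfl
    | str hZ c hc =>
      cases c with
      | nil => exact (not_nonempty_fiber_nil hc).elim
      | emit => exact (not_nonempty_fiber_emit hc).elim
      | tm => cases congrArg Unfolding.prod h
      | bin => cases congrArg Unfolding.prod h
  | str hZ c hc =>
    cases y with
    | pre => cases hZ
    | pair => cases hZ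
    | empty =>
      cases c with
      | nil => exact (not_nonempty_fiber_nil hc).elim
      | emit => exact (not_nonempty_fiber_emit hc).elim
      | tm => cases congrArg Unfolding.prod h
      | bin => cases congrArg Unfolding.prod h
    | str hZ' c' hc' =>
      obtain rfl := hZ.topSort_eq
      obtain rfl := hZ'.topSort_eq
      cases c with
      | nil => exact (not_nonempty_fiber_nil hc).elim
      | emit => exact (not_nonempty_fiber_emit hc).elim
      | tm a =>
        cases c' with
        | nil => exact (not_nonempty_fiber_nil hc').elim
        | emit => exact (not_nonempty_fiber_emit hc').elim
        | tm => cases congrArg Unfolding.prod h; rfl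
        | bin => cases congrArg Unfolding.prod h
      | bin q₁ q₂ c₁ c₂ =>
        cases c' with
        | nil => exact (not_nonempty_fiber_nil hc').elim
        | emit => exact (not_nonempty_fiber_emit hc').elim
        | tm => cases congrArg Unfolding.prod h
        | bin =>
          cases congrArg Unfolding.prod h
          cases (Prod.mk.inj (eq_of_heq (Unfolding.mk.inj h).2.2)).1
          rfl
  | pair c hc s =>
    cases y with
    | str hZ => cases hZ
    | pair c' hc' s' =>
      cases c with
      | nil => exact (not_nonempty_fiber_nil hc).elim
      | tm a =>
        rcases c' with _ | _ | _ | ⟨_ | _, _, _⟩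
        · exact (not_nonempty_fiber_nil hc').elim
        · cases congrArg Unfolding.prod h
          cases (Prod.mk.inj (Prod.mk.inj (eq_of_heq (Unfolding.mk.inj h).2.2)).2).1
          rfl
        · cases congrArg Unfolding.prod h
        · cases congrArg Unfolding.prod h
        · cases congrArg Unfolding.prod h
      | bin q₁ q₂ c₁ c₂ =>
        rcases c' with _ | _ | _ | ⟨_ | _, _, _⟩
        · exact (not_nonempty_fiber_nil hc').elim
        · cases congrArg Unfolding.prod h
        · cases congrArg Unfolding.prod h
          cases (Prod.mk.inj (eq_of_heq (Unfolding.mk.inj h).2.2)).1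
          rfl
        · cases congrArg Unfolding.prod h
        · cases congrArg Unfolding.prod h
      | emit d q₁ c₁ =>
        cases d with
        | false =>
          rcases c' with _ | _ | _ | ⟨_ | _, _, _⟩
          · exact (not_nonempty_fiber_nil hc').elim
          · cases congrArg Unfolding.prod h
          · cases congrArg Unfolding.prod h
          · cases congrArg Unfolding.prod h
            obtain ⟨h1, h2⟩ := Prod.mk.inj (eq_of_heq (Unfolding.mk.inj h).2.2)
            cases h1
            cases (Prod.mk.inj h2).1
            rfl
          · cases congrArg Unfolding.prod h
        | true =>
          rcases c' with _ | _ | _ | ⟨_ | _, _, _⟩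
          · exact (not_nonempty_fiber_nil hc').elim
          · cases congrArg Unfolding.prod h
          · cases congrArg Unfolding.prod h
          · cases congrArg Unfolding.prod h
          · cases congrArg Unfolding.prod h
            obtain ⟨h1, h2⟩ := Prod.mk.inj (eq_of_heq (Unfolding.mk.inj h).2.2)
            cases h1
            cases (Prod.mk.inj h2).1
            rfl

theorem yield_unfold {Z : NT T Q} {σ : List (SS Q)} (x : H.Obj q₀ Z σ) :
    x.yield = x.unfold.kids.yield yield := by
  cases x with
  | pre a => rfl
  | empty h => rfl
  | str hZ c hc =>
    cases c with
    | nil => exact (not_nonempty_fiber_nil hc).elim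
    | tm a => rfl
    | bin q₁ q₂ c₁ c₂ =>
      exact (join_nest _ _).trans (List.append_nil _).symm
    | emit d q₁ c => exact (not_nonempty_fiber_emit hc).elim
  | pair c hc s =>
    cases c with
    | nil => exact (not_nonempty_fiber_nil hc).elim
    | tm a => rfl
    | bin q₁ q₂ c₁ c₂ =>
      change _ = (c₁.yield.1 ++ (c₂.yield.1 ++ s.yield ++ c₂.yield.2) ++ c₁.yield.2) ++ []
      simp [yield, CTree.yield, nest]
    | emit d q₁ c =>
      cases d with
      | true =>
        change join c.yield ++ s.yield ++ [] = join c.yield ++ (s.yield ++ [])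
        simp
      | false =>
        change [] ++ s.yield ++ join c.yield = s.yield ++ (join c.yield ++ [])
        simp

theorem size_unfold {Z : NT T Q} {σ : List (SS Q)} (x : H.Obj q₀ Z σ) :
    x.unfold.kids.size size < x.size := by
  cases x with
  | pre a => exact Nat.zero_lt_one
  | empty h => exact Nat.zero_lt_one
  | str hZ c hc =>
    cases c with
    | nil => exact (not_nonempty_fiber_nil hc).elim
    | tm a => exact Nat.zero_lt_two
    | bin q₁ q₂ c₁ c₂ =>
      change c₁.size + c₂.size + 0 < c₁.size + c₂.size + 1
      omega
    | emit d q₁ c => exact (not_nonempty_fiber_emit hc).elim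
  | pair c hc s =>
    cases c with
    | nil => exact (not_nonempty_fiber_nil hc).elim
    | tm a =>
      change 1 + (s.size + 0) < 2 + s.size
      omega
    | bin q₁ q₂ c₁ c₂ =>
      change c₁.size + (c₂.size + s.size) + 0 < c₁.size + c₂.size + 1 + s.size
      omega
    | emit d q₁ c =>
      cases d with
      | true =>
        change c.size + (s.size + 0) < c.size + 1 + s.size
        omega
      | false =>
        change s.size + (c.size + 0) < c.size + 1 + s.size
        omega

end Obj

open Classical in
/-- The tree of the normal form grammar to which a tree contracts. -/
noncomputable def Tree.toObj (t : H.Tree q₀) : H.Obj q₀ .start [.bot] :=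
  if h : t.Null then .empty ⟨t, h⟩ else .str .start (t.contract false) ⟨t, h, rfl⟩

theorem Tree.toObj_eq_empty {t : H.Tree q₀} {h : Nonempty {t : H.Tree q₀ // t.Null}} :
    t.toObj = .empty h ↔ t.Null := by
  unfold Tree.toObj
  split_ifs with ht <;> simp [ht]

theorem Tree.toObj_eq_str {t : H.Tree q₀} {hZ : Bottom q₀ .start .bot q₀} {c : CTree T Q}
    {hc : Nonempty (H.Fiber false q₀ c)} :
    t.toObj = .str hZ c hc ↔ ¬ t.Null ∧ t.contract false = c := by
  unfold Tree.toObj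
  split_ifs with ht <;> simp [ht]

theorem Tree.yield_toObj (t : H.Tree q₀) : t.toObj.yield = join t.yield := by
  unfold Tree.toObj
  split_ifs with ht
  · exact (join_eq_nil.2 ht).symm
  · exact (yield_contract t).2

/-- Contraction, restricted to the trees that derive `s`. -/
noncomputable def contractTo (s : List T) (t : {t : H.Tree q₀ // join t.yield = s}) :
    {x : H.Obj q₀ .start [.bot] // x.yield = s} :=
  ⟨t.1.toObj, t.1.yield_toObj.trans t.2⟩

theorem contractTo_surjective (s : List T) :
    Function.Surjective (contractTo (H := H) (q₀ := q₀) s) := by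
  rintro ⟨x, hx⟩
  have h : ∃ t : H.Tree q₀, t.toObj = x := by
    cases x with
    | empty h =>
      obtain ⟨t, ht⟩ := h
      exact ⟨t, Tree.toObj_eq_empty.2 ht⟩
    | str hZ c hc =>
      cases hZ
      obtain ⟨t, ht⟩ := id hc
      exact ⟨t, Tree.toObj_eq_str.2 ht⟩
  obtain ⟨t, rfl⟩ := h
  exact ⟨⟨t, t.yield_toObj.symm.trans hx⟩, rfl⟩

section Weights

variable [CommSemiring K] (S : Summation K)

variable (H q₀)

/-- The sum of the weights of the unary paths from `q` to a node of the given shape. -/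
noncomputable def pathSum (m : Bool) (q : Q) (sh : Shape T Q) : K :=
  S.sum fun k : H.UnaryPath m q sh => k.weight

/-- The sum of the weights of the null trees of sort `q₀`. -/
noncomputable def nullSum : K := S.sum fun t : {t : H.Tree q₀ // t.Null} => t.1.weight

/-- The weights of the productions of the normal form grammar.  A production that rewrites a symbol
of sort `q` weighs as much as all unary paths from `q` to a node of the corresponding shape
together; the weight of a terminal in pair mode is that of the production that emits `pre a`.
Productions outside `ruleSet` are irrelevant and get the weight `0`. -/
noncomputable def ruleWeight : Production T (NT T Q) (SS Q) → K
  | .leaf (.pre _) _ _ => 1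
  | .leaf _ _ none => H.nullSum q₀ S
  | .leaf Z [A] (some a) => H.pathSum S false (topSort q₀ Z A) (.tm a)
  | .spine Z [A] [] _ [.sy m q₂, .sy _ q₁] [] =>
    H.pathSum S m (topSort q₀ Z A) (.bin q₁ q₂)
  | .spine _ [.sy _ q] [.nt (.pre a) _] _ _ _ => H.pathSum S true q (.tm a)
  | .spine _ [.sy _ q] [.nt (.str q₁) _] _ _ _ => H.pathSum S true q (.emit true q₁)
  | .spine _ [.sy _ q] _ _ _ [.nt (.str q₁) _] => H.pathSum S true q (.emit false q₁)
  | _ => 0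

/-- The normal form grammar of a head grammar.  A stack of sorts is a sequence of pairs of strings
to be nested into each other; a push replaces a sort by the two sorts of a composition, and a
binary production without push emits one side of the innermost gap. -/
noncomputable def normalForm [Finite T] [Finite Q] : WLIG K T (NT T Q) (SS Q) where
  rules := H.ruleSet q₀
  start := .start
  initStack := [.bot]
  weight := H.ruleWeight q₀ S

theorem isNormalForm_normalForm [Finite T] [Finite Q] : (H.normalForm q₀ S).IsNormalForm := by
  refine ⟨.bot, rfl, fun p hp => ?_⟩
  cases (H.mem_ruleSet q₀).1 hp with
  | pre a => exact .terminal _ _ _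
  | empty h => exact .startEmpty
  | strTm hZ h => exact .terminal _ _ _
  | strBin hZ h => exact .push _ _ _ _ _
  | pairTm h => exact .binRight _ _ _ _ _ (Nat.zero_le _)
  | pairBin h => exact .push _ _ _ _ _
  | pairLeft h => exact .binRight _ _ _ _ _ (Nat.zero_le _)
  | pairRight h => exact .binLeft _ _ _ _ _ (Nat.zero_le _)

theorem topDownRule_of_mem [Finite T] [Finite Q] (p : Production T (NT T Q) (SS Q))
    (hp : p ∈ (H.normalForm q₀ S).rules) : WLIG.TopDownRule .bot p := by
  cases (H.mem_ruleSet q₀).1 hp with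
  | pre a => exact .leaf _ _ _
  | empty h => exact .leaf _ _ _
  | strTm hZ h => exact .leaf _ _ _
  | strBin hZ h => exact .spine _ _ _ _ _ _ (by simp) (by simp)
  | pairTm h => exact .spine _ _ _ _ _ _ (by simp) (by simp)
  | pairBin h => exact .spine _ _ _ _ _ _ (by simp) (by simp)
  | pairLeft h => exact .spine _ _ _ _ _ _ (by simp) (by simp)
  | pairRight h => exact .spine _ _ _ _ _ _ (by simp) (by simp)

variable {H q₀}

namespace Obj

/-- The weight of a tree. -/
noncomputable def weight : {Z : NT T Q} → {σ : List (SS Q)} → H.Obj q₀ Z σ → K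
  | _, _, .pre _ => 1
  | _, _, .empty _ => H.nullSum q₀ S
  | _, _, .str (q := q) _ c _ => H.contractedWeight S false q c
  | _, _, .pair (q := q) c _ s => H.contractedWeight S true q c * s.weight

variable [Finite T] [Finite Q]

theorem weight_unfold {Z : NT T Q} {σ : List (SS Q)} (x : H.Obj q₀ Z σ) :
    x.weight S = H.ruleWeight q₀ S x.unfold.prod * x.unfold.kids.weight (weight S) := by
  cases x with
  | pre a => exact (mul_one _).symm
  | empty h => exact (mul_one _).symm
  | str hZ c hc =>
    cases c with
    | nil => exact (not_nonempty_fiber_nil hc).elim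
    | tm a =>
      refine Eq.trans ?_ (mul_one _).symm
      cases hZ <;> rfl
    | bin q₁ q₂ c₁ c₂ =>
      obtain rfl := hZ.topSort_eq
      change H.pathSum S false (topSort q₀ _ _) (.bin q₁ q₂) *
        (H.contractedWeight S true q₁ c₁ * H.contractedWeight S false q₂ c₂) =
          H.pathSum S false (topSort q₀ _ _) (.bin q₁ q₂) *
            (H.contractedWeight S true q₁ c₁ * H.contractedWeight S false q₂ c₂ * 1)
      rw [mul_one]
    | emit d q₁ c => exact (not_nonempty_fiber_emit hc).elim
  | @pair q ρ c hc s =>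
    cases c with
    | nil => exact (not_nonempty_fiber_nil hc).elim
    | tm a =>
      change H.pathSum S true q (.tm a) * s.weight S = H.pathSum S true q (.tm a) *
        (1 * (s.weight S * 1))
      ring
    | bin q₁ q₂ c₁ c₂ =>
      change H.pathSum S true q (.bin q₁ q₂) * (H.contractedWeight S true q₁ c₁ *
        H.contractedWeight S true q₂ c₂) * s.weight S = H.pathSum S true q (.bin q₁ q₂) *
        (H.contractedWeight S true q₁ c₁ * (H.contractedWeight S true q₂ c₂ * s.weight S) * 1)
      ring
    | emit d q₁ c =>
      cases d with
      | true =>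
        change H.pathSum S true q (.emit true q₁) * H.contractedWeight S false q₁ c * s.weight S =
          H.pathSum S true q (.emit true q₁) *
            (H.contractedWeight S false q₁ c * (s.weight S * 1))
        ring
      | false =>
        change H.pathSum S true q (.emit false q₁) * H.contractedWeight S false q₁ c * s.weight S =
          H.pathSum S true q (.emit false q₁) *
            (s.weight S * (H.contractedWeight S false q₁ c * 1))
        ring

variable (H q₀) in
/-- The derivation trees of the normal form grammar. -/
noncomputable def model :
    TreeModel (H.normalForm q₀ S).rules .bot (H.normalForm q₀ S).weight where
  E := H.Obj q₀
  yield := yield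
  weight := weight S
  size := size
  unfold := unfold
  unfold_injective h := unfold_injective h
  unfold_surjective := unfold_surjective
  yield_eq := yield_unfold
  weight_eq := weight_unfold S
  size_lt := size_unfold

end Obj

/-- Contraction preserves the sum of the weights of all trees that derive `s`. -/
theorem sum_contractTo (s : List T)
    (hd : S.Dom {t : H.Tree q₀ // join t.yield = s}) :
    (S.sum fun t : {t : H.Tree q₀ // join t.yield = s} => t.1.weight) =
      S.sum fun x : {x : H.Obj q₀ .start [.bot] // x.yield = s} => x.1.weight S := by
  refine S.sum_eq_of_fibers (contractTo s) (contractTo_surjective s) hd _ _ ?_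
  -- The fibre over the empty tree consists of the null trees, the others are fibres of contraction.
  rintro ⟨x, hx⟩ hdx
  cases x with
  | empty h =>
    let e : {t : {t : H.Tree q₀ // join t.yield = s} // contractTo s t = ⟨.empty h, hx⟩} ≃
        {t : H.Tree q₀ // t.Null} :=
      { toFun := fun t => ⟨t.1.1, Tree.toObj_eq_empty.1 (congrArg Subtype.val t.2)⟩
        invFun := fun t => ⟨⟨t.1, (join_eq_nil.2 t.2).trans hx⟩,
          Subtype.ext (Tree.toObj_eq_empty.2 t.2)⟩
        left_inv := fun _ => rfl
        right_inv := fun _ => rfl }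
    exact S.sum_equiv e hdx _ _ fun _ => rfl
  | str hZ c hc =>
    cases hZ
    let e : {t : {t : H.Tree q₀ // join t.yield = s} // contractTo s t = ⟨.str .start c hc, hx⟩} ≃
        H.Fiber false q₀ c :=
      { toFun := fun t => ⟨t.1.1, Tree.toObj_eq_str.1 (congrArg Subtype.val t.2)⟩
        invFun := fun t => ⟨⟨t.1, t.1.yield_toObj.symm.trans
          ((congrArg Obj.yield (Tree.toObj_eq_str.2 t.2)).trans hx)⟩,
          Subtype.ext (Tree.toObj_eq_str.2 t.2)⟩
        left_inv := fun _ => rfl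
        right_inv := fun _ => rfl }
    exact (S.sum_equiv e hdx _ _ fun _ => rfl).trans
      (sum_fiber S c false q₀ hc (S.dom_equiv e hdx))

end Weights

end HeadGrammar

/-! ### Existence of normal forms -/

namespace WLIG

open HeadGrammar

variable {K : Type*} [CommSemiring K] {T N Γ : Type} [Finite T] [Finite N] [Finite Γ]

/-- The normal form theorem for an arbitrary notion of sums that covers the derivations of every
string. -/
theorem exists_normalForm (S : Summation K) (G : WLIG K T N Γ) (hG : G.IsTopDown)
    (hd : ∀ s, S.Dom (G.derivations s)) :
    ∃ (N' Γ' : Type) (_ : Finite N') (_ : Finite Γ') (G' : WLIG K T N' Γ'),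
      G'.IsTopDown ∧ G'.IsNormalForm ∧ G.language = G'.language ∧ ∀ s,
        S.Dom (G'.derivations s) ∧
        (S.sum fun d : G.derivations s => G.derivationWeight d.1) =
          S.sum fun d : G'.derivations s => G'.derivationWeight d.1 := by
  obtain ⟨Q, _, H, q₀, hH⟩ := exists_headGrammar G hG
  have hN := H.topDownRule_of_mem q₀ S
  have key : ∀ s, ∃ f : G.derivations s → (H.normalForm q₀ S).derivations s,
      Function.Surjective f ∧ (S.sum fun d : G.derivations s => G.derivationWeight d.1) =
        S.sum fun d : (H.normalForm q₀ S).derivations s =>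
          (H.normalForm q₀ S).derivationWeight d.1 := by
    intro s
    obtain ⟨e, he⟩ := hH s
    obtain ⟨e', he'⟩ := TreeModel.exists_equiv_derivations (H.normalForm q₀ S) rfl hN
      (Obj.model H q₀ S) s
    have hd₁ := S.dom_equiv e (hd s)
    have hd₂ := S.dom_of_surjective _ (contractTo_surjective s) hd₁
    refine ⟨fun d => e' (contractTo s (e d)),
      e'.surjective.comp ((contractTo_surjective s).comp e.surjective), ?_⟩
    rw [S.sum_equiv e (hd s) _ (fun t => t.1.weight) he, sum_contractTo S s hd₁]
    exact S.sum_equiv e' hd₂ _ (fun d => (H.normalForm q₀ S).derivationWeight d.1) he'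
  refine ⟨_, _, inferInstance, inferInstance, H.normalForm q₀ S, ⟨_, rfl, hN⟩,
    H.isNormalForm_normalForm q₀ S, ?_, fun s => ?_⟩
  · ext s
    obtain ⟨f, hf, -⟩ := key s
    constructor
    · rintro ⟨d, hd⟩
      exact ⟨_, (f ⟨d, hd⟩).2⟩
    · rintro ⟨d, hd⟩
      obtain ⟨d', -⟩ := hf ⟨d, hd⟩
      exact ⟨_, d'.2⟩
  · obtain ⟨f, hf, h⟩ := key s
    exact ⟨S.dom_of_surjective f hf (hd s), h⟩

end WLIG

theorem mainTheorem8 {K : Type*} [CommSemiring K] {T N Γ : Type} [Finite T] [Finite N] [Finite Γ]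
    (G : WLIG K T N Γ) (hG : G.IsTopDown) :
    (∀ [CountableSums K],
      ∃ (N' Γ' : Type) (_ : Finite N') (_ : Finite Γ') (G' : WLIG K T N' Γ'),
        G'.IsTopDown ∧ G'.IsNormalForm ∧ G.WeaklyEquivalent G') ∧
    (G.FinitelyAmbiguous →
      ∃ (N' Γ' : Type) (_ : Finite N') (_ : Finite Γ') (G' : WLIG K T N' Γ'),
        G'.IsTopDown ∧ G'.IsNormalForm ∧ G'.FinitelyAmbiguous ∧ G.FinWeaklyEquivalent G') := by
  constructor
  · intro _
    obtain ⟨N', Γ', _, _, G', h1, h2, h3, h4⟩ := G.exists_normalForm (CountableSums.summation K) hG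
      fun s => (inferInstance : Countable (G.derivations s))
    refine ⟨N', Γ', ‹_›, ‹_›, G', h1, h2, h3, fun s => ?_⟩
    have h := (h4 s).2
    rw [CountableSums.summation_sum, CountableSums.summation_sum] at h
    exact h
  · intro hfin
    obtain ⟨N', Γ', _, _, G', h1, h2, h3, h4⟩ := G.exists_normalForm (finiteSummation K) hG
      fun s => (hfin s).to_subtype
    refine ⟨N', Γ', ‹_›, ‹_›, G', h1, h2, fun s => Set.finite_coe_iff.1 (h4 s).1, h3,
      fun s => ?_⟩
    have h := (h4 s).2
    unfold WLIG.finStringsum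
    rw [← finsum_set_coe_eq_finsum_mem, ← finsum_set_coe_eq_finsum_mem]
    exact h
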